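/- Let $A$ be a $C^*$-algebra and let $E,F$ be Hilbert $C^*$-modules over $A$ (the side on which $A$ acts is immaterial). For a subset $S$ of a Hilbert module put $S^\perp=\{x:\langle x,y\rangle=0\ \text{for all } y\in S\}$; $S$ is *essential* if $S^\perp=\{0\}$. An *operator* $t:E\to F$ is a $\mathbb C$-linear and $A$-linear map from an $A$-submodule $D(t)$ of $E$ into $F$, with graph $G(t)$, null space $N(t)$ and range $R(t)$; $s\subseteq t$ means that $t$ extends $s$. Compositions, sums and inverses of operators have their natural domains. If $D(t)$ is essential, the adjoint $t^*:F\to E$ is defined by: $y\in D(t^*)$ and $t^*y=z$ if and only if $\langle tx,y\rangle=\langle x,z\rangle$ for all $x\in D(t)$. * $t$ is *graph regular* if $D(t)$ is essential, $G(t)^{\perp\perp}=G(t)$ and $G(t)\oplus G(t)^\perp=E\oplus F$. * $t$ is *regular* if it is closed, $D(t)$ is dense in $E$, $D(t^*)$ is dense in $F$, and $R(1+t^*t)$ is dense in $E$. * $t$ is *adjointable*, $t\in\mathcal L(E,F)$, if $D(t)=E$ and $D(t^*)=F$. For a positive $a\in\mathcal L(E,E)$, $a^{1/2}$ denotes its unique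 positive adjointable square root. * $\mathcal Z^d(E,F)$ is the set of $z\in\mathcal L(E,F)$ with $\|z\|\le 1$, $N(1-z^*z)=\{0\}$ and $R(1-z^*z)$ dense in $E$. For such $z$ the operator $t_z:E\to F$ has domain $(1-z^*z)^{1/2}E$ and $t_z\big((1-z^*z)^{1/2}x\big)=zx$ for $x\in E$. For graph regular $t:E\to F$ put $$a_t=(1+t^*t)^{-1},\qquad b_t=t(1+t^*t)^{-1},\qquad z_t=t\,a_t^{1/2}\restriction_{\overline{D(t^*t)}},$$ and let $a_{t^*}$, $z_{t^*}$ be the corresponding operators for $t^*:F\to E$. **Theorem.** Let $t:E\to F$ be graph regular and set $E_0=\overline{D(t^*t)}$, $F_0=\overline{D(tt^*)}$, which are Hilbert $A$-modules with the inherited structure. Then: 1. $D(z_t)=E_0$, $z_t$ maps $E_0$ into $F_0$, and as an operator from $E_0$ to $F_0$ it satisfies $z_t\in\mathcal Z^d(E_0,F_0)$ and $z_t^*=z_{t^*}$, the adjoint being taken in $\mathcal L(E_0,F_0)$. 2. The operator $a_{t^*}^{1/2}t$ is closable, and $z_t=\overline{a_{t^*}^{1/2}t}\restriction_{E_0}$.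 3. $N(z_t)=N(t)$ and $R(z_t)\subseteq R(t)$. 4. $a_t=(1-z_{t^*}z_t)^*$, $a_{t^*}=(1-z_tz_{t^*})^*$ and $b_t=z_t\,a_t^{1/2}$. Here $1-z_{t^*}z_t$ is the operator from $E$ to $E$ with domain $E_0$, $1-z_tz_{t^*}$ is the operator from $F$ to $F$ with domain $F_0$, and the adjoints are those of operators on $E$ and on $F$. 5. The operator $t_{\mathrm{reg}}:=t_{z_t}$, formed from $z_t\in\mathcal Z^d(E_0,F_0)$, is a regular operator from $E_0$ to $F_0$, and $t_{\mathrm{reg}}\subseteq t=(t_{z_t})^{**}$, where $(t_{z_t})^{**}$ is the biadjoint of $t_{z_t}$ considered as an operator from $E$ to $F$. -/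

import Mathlib

open scoped InnerProductSpace

set_option linter.unusedSectionVars false

/-! Throughout, `A` is a (not necessarily unital) C⋆-algebra and `E`, `F`, `G` are Hilbert
`A`-modules: `CStarModule A E` together with completeness.  Mathlib writes the module action on the
left; `⟪x, y⟫_A` is `A`-linear and `ℂ`-linear in `y`, and a right Hilbert `B`-module is the same
thing as a `CStarModule` over the C⋆-algebra `Bᵐᵒᵖ`. -/

namespace HilbertModule

section Basic

variable {A E : Type*} [NonUnitalCStarAlgebra A] [PartialOrder A] [StarOrderedRing A]
  [NormedAddCommGroup E] [NormedSpace ℂ E] [SMul A E] [CStarModule A E]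

/-- A vector is determined by its inner products with all vectors. -/
theorem ext_inner {x y : E} (h : ∀ z : E, ⟪z, x⟫_A = ⟪z, y⟫_A) : x = y := by
  have h0 : ⟪x - y, x - y⟫_A = 0 := by
    rw [CStarModule.inner_sub_right, h, sub_self]
  exact sub_eq_zero.mp (CStarModule.inner_self.mp h0)

theorem smul_add (a : A) (x y : E) : a • (x + y) = a • x + a • y :=
  ext_inner (A := A) fun z => by simp [mul_add]

theorem smul_sub (a : A) (x y : E) : a • (x - y) = a • x - a • y :=
  ext_inner (A := A) fun z => by simp [mul_sub]

theorem smul_zero (a : A) : a • (0 : E) = 0 :=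
  ext_inner (A := A) fun z => by simp

theorem norm_smul_le (a : A) (x : E) : ‖a • x‖ ≤ ‖a‖ * ‖x‖ := by
  have h : ‖a • x‖ ^ 2 ≤ (‖a‖ * ‖x‖) ^ 2 := by
    rw [CStarModule.norm_sq_eq A, mul_pow, CStarModule.norm_sq_eq A (x := x)]
    simp only [CStarModule.inner_op_smul_right, CStarModule.inner_op_smul_left]
    calc ‖a * (⟪x, x⟫_A * star a)‖ ≤ ‖a‖ * (‖⟪x, x⟫_A‖ * ‖star a‖) :=
          (norm_mul_le _ _).trans (mul_le_mul_of_nonneg_left (norm_mul_le _ _) (norm_nonneg _))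
      _ = ‖a‖ ^ 2 * ‖⟪x, x⟫_A‖ := by rw [norm_star]; ring
  exact le_of_sq_le_sq h (by positivity)

theorem continuous_smul (a : A) : Continuous fun x : E => a • x := by
  refine (LipschitzWith.of_dist_le_mul (K := ‖a‖₊) fun x y => ?_).continuous
  rw [dist_eq_norm, dist_eq_norm, ← smul_sub]
  exact norm_smul_le a (x - y)

variable (A) in
/-- The orthogonal complement `S^⊥ = {x | ⟪x, y⟫ = 0 for all y ∈ S}` of a subset of a Hilbert
module. -/
def ortho (S : Set E) : Submodule ℂ E where
  carrier := {x | ∀ y ∈ S, ⟪x, y⟫_A = 0}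
  add_mem' hx hy z hz := by rw [CStarModule.inner_add_left, hx z hz, hy z hz, add_zero]
  zero_mem' z _ := CStarModule.inner_zero_left
  smul_mem' c x hx z hz := by
    rw [CStarModule.inner_smul_left_complex, hx z hz, _root_.smul_zero]

variable (A) in
/-- A subset is essential if its orthogonal complement is `{0}`. -/
def IsEssential (S : Set E) : Prop := ortho A S = ⊥

end Basic

/-- An `A`-submodule of `E` (which is also a complex subspace). -/
structure HilbertSubmodule (A E : Type*) [NormedAddCommGroup E] [NormedSpace ℂ E] [SMul A E]
    extends Submodule ℂ E where
  op_smul_mem : ∀ (a : A) (x : E), x ∈ toSubmodule → a • x ∈ toSubmodule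

section Submodule

variable {A E : Type*} [NonUnitalCStarAlgebra A] [PartialOrder A] [StarOrderedRing A]
  [NormedAddCommGroup E] [NormedSpace ℂ E] [SMul A E] [CStarModule A E]

instance (S : HilbertSubmodule A E) : SMul A S.toSubmodule :=
  ⟨fun a x => ⟨a • (x : E), S.op_smul_mem a x x.2⟩⟩

/-- An `A`-submodule of a Hilbert `A`-module, with the inherited `A`-valued inner product. -/
instance (S : HilbertSubmodule A E) : CStarModule A S.toSubmodule where
  inner x y := ⟪(x : E), (y : E)⟫_A
  inner_add_right := CStarModule.inner_add_right (E := E)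
  inner_self_nonneg := CStarModule.inner_self_nonneg (E := E)
  inner_self {x} := (CStarModule.inner_self (A := A) (x := (x : E))).trans
    ⟨fun h => Subtype.ext h, fun h => congrArg Subtype.val h⟩
  inner_op_smul_right := CStarModule.inner_op_smul_right (E := E)
  inner_smul_right_complex := CStarModule.inner_smul_right_complex (E := E)
  star_inner x y := CStarModule.star_inner (x : E) (y : E)
  norm_eq_sqrt_norm_inner_self x := CStarModule.norm_eq_sqrt_norm_inner_self (A := A) (x : E)

/-- The norm closure of an `A`-submodule. -/
def HilbertSubmodule.closure (S : HilbertSubmodule A E) : HilbertSubmodule A E where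
  toSubmodule := S.toSubmodule.topologicalClosure
  op_smul_mem a _ hx := map_mem_closure (continuous_smul a) hx fun y hy => S.op_smul_mem a y hy

end Submodule

/-- An operator from `E` into `F`: a `ℂ`-linear and `A`-linear map defined on an `A`-submodule
`domain` of `E`, with values in `F`. -/
structure HilbertOp (A E F : Type*) [NormedAddCommGroup E] [NormedSpace ℂ E] [SMul A E]
    [NormedAddCommGroup F] [NormedSpace ℂ F] [SMul A F] extends E →ₗ.[ℂ] F where
  op_smul : ∀ (a : A) (x : domain), ∃ h : a • (x : E) ∈ domain, toFun ⟨a • (x : E), h⟩ = a • toFun x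

namespace HilbertOp

section

variable {A E F G : Type*} [NonUnitalCStarAlgebra A] [PartialOrder A] [StarOrderedRing A]
  [NormedAddCommGroup E] [NormedSpace ℂ E] [SMul A E] [CStarModule A E]
  [NormedAddCommGroup F] [NormedSpace ℂ F] [SMul A F] [CStarModule A F]
  [NormedAddCommGroup G] [NormedSpace ℂ G] [SMul A G] [CStarModule A G]

/-- The domain of `t` as an `A`-submodule. -/
def dom (t : HilbertOp A E F) : HilbertSubmodule A E where
  toSubmodule := t.domain
  op_smul_mem a x hx := (t.op_smul a ⟨x, hx⟩).1

/-- The graph of `t`. -/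
def gr (t : HilbertOp A E F) : Submodule ℂ (E × F) := t.toLinearPMap.graph

theorem op_smul_mem_gr (t : HilbertOp A E F) (a : A) {x : E} {y : F} (h : (x, y) ∈ t.gr) :
    (a • x, a • y) ∈ t.gr := by
  obtain ⟨u, rfl, rfl⟩ := (LinearPMap.mem_graph_iff _).mp h
  obtain ⟨h1, h2⟩ := t.op_smul a u
  exact (LinearPMap.mem_graph_iff _).mpr ⟨⟨_, h1⟩, rfl, h2⟩

/-- The operator whose graph is the given `A`-submodule `g` of `E × F`.  It is meaningful only if
`g` is the graph of a map; see `gr_ofGraph`. -/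
noncomputable def ofGraph (g : Submodule ℂ (E × F))
    (hg : ∀ (a : A) (x : E) (y : F), (x, y) ∈ g → (a • x, a • y) ∈ g) : HilbertOp A E F where
  toLinearPMap := g.toLinearPMap
  op_smul a x := by
    have hx : (a • (x : E)) ∈ g.toLinearPMap.domain := by
      obtain ⟨⟨u, v⟩, huv, hu⟩ := x.2
      exact ⟨(a • u, a • v), hg a u v huv, by rw [← hu]; rfl⟩
    refine ⟨hx, ?_⟩
    by_cases hf : ∀ (p : E × F) (_ : p ∈ g) (_ : p.fst = 0), p.snd = 0
    · have h1 := g.mem_graph_toLinearPMap hf ⟨_, hx⟩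
      have h2 := hg a _ _ (g.mem_graph_toLinearPMap hf x)
      have h3 := hf _ (g.sub_mem h1 h2) (by simp)
      exact sub_eq_zero.mp h3
    · have h0 : g.toLinearPMap.toFun = 0 := by
        simp only [Submodule.toLinearPMap, dif_neg hf]
        rfl
      rw [h0]
      change (0 : F) = a • (0 : F)
      exact (HilbertModule.smul_zero a).symm

theorem gr_ofGraph (g : Submodule ℂ (E × F))
    (hg : ∀ (a : A) (x : E) (y : F), (x, y) ∈ g → (a • x, a • y) ∈ g)
    (hf : ∀ p ∈ g, p.fst = 0 → p.snd = 0) : (ofGraph g hg).gr = g :=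
  Submodule.toLinearPMap_graph_eq g hf

/-- The null space of `t`. -/
def null (t : HilbertOp A E F) : Set E := {x | (x, 0) ∈ t.gr}

/-- The range of `t`. -/
def range (t : HilbertOp A E F) : Set F := {y | ∃ x, (x, y) ∈ t.gr}

/-- `t` is an extension of `s`. -/
instance : LE (HilbertOp A E F) := ⟨fun s t => s.toLinearPMap ≤ t.toLinearPMap⟩

/-- The identity operator. -/
instance : One (HilbertOp A E E) :=
  ⟨{ toLinearPMap := LinearMap.id.toPMap ⊤, op_smul := fun _ _ => ⟨trivial, rfl⟩ }⟩

/-- The sum, with domain the intersection of the domains. -/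
instance : Add (HilbertOp A E F) :=
  ⟨fun s t =>
    { toLinearPMap := s.toLinearPMap + t.toLinearPMap
      op_smul := fun a x => by
        obtain ⟨h1, h2⟩ := s.op_smul a ⟨x, x.2.1⟩
        obtain ⟨h3, h4⟩ := t.op_smul a ⟨x, x.2.2⟩
        refine ⟨⟨h1, h3⟩, ?_⟩
        exact (congrArg₂ (· + ·) h2 h4).trans (HilbertModule.smul_add a _ _).symm }⟩

/-- The difference, with domain the intersection of the domains. -/
instance : Sub (HilbertOp A E F) :=
  ⟨fun s t =>
    { toLinearPMap := s.toLinearPMap - t.toLinearPMap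
      op_smul := fun a x => by
        obtain ⟨h1, h2⟩ := s.op_smul a ⟨x, x.2.1⟩
        obtain ⟨h3, h4⟩ := t.op_smul a ⟨x, x.2.2⟩
        refine ⟨⟨h1, h3⟩, ?_⟩
        exact (congrArg₂ (· - ·) h2 h4).trans (HilbertModule.smul_sub a _ _).symm }⟩

/-- The composition `s t`, with domain `{x ∈ D(t) | t x ∈ D(s)}`. -/
noncomputable def comp (s : HilbertOp A F G) (t : HilbertOp A E F) : HilbertOp A E G :=
  ofGraph
    { carrier := {p | ∃ y, (p.1, y) ∈ t.gr ∧ (y, p.2) ∈ s.gr}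
      add_mem' := by
        rintro p q ⟨y, h1, h2⟩ ⟨z, h3, h4⟩
        exact ⟨y + z, t.gr.add_mem h1 h3, s.gr.add_mem h2 h4⟩
      zero_mem' := ⟨0, t.gr.zero_mem, s.gr.zero_mem⟩
      smul_mem' := by
        rintro c p ⟨y, h1, h2⟩
        exact ⟨c • y, t.gr.smul_mem c h1, s.gr.smul_mem c h2⟩ }
    (by
      rintro a x z ⟨y, h1, h2⟩
      exact ⟨a • y, t.op_smul_mem_gr a h1, s.op_smul_mem_gr a h2⟩)

theorem op_smul_mem_swap (t : HilbertOp A E F) (a : A) (y : F) (x : E)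
    (h : (y, x) ∈ t.gr.comap (LinearEquiv.prodComm ℂ F E : F × E →ₗ[ℂ] E × F)) :
    (a • y, a • x) ∈ t.gr.comap (LinearEquiv.prodComm ℂ F E : F × E →ₗ[ℂ] E × F) :=
  t.op_smul_mem_gr a h

/-- The inverse of an injective operator, with domain the range. -/
noncomputable def inv (t : HilbertOp A E F) : HilbertOp A F E :=
  ofGraph (t.gr.comap (LinearEquiv.prodComm ℂ F E : F × E →ₗ[ℂ] E × F))
    t.op_smul_mem_swap

/-- The restriction of `t` to an `A`-submodule `S`, with domain `S ∩ D(t)`. -/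
def restrict (t : HilbertOp A E F) (S : HilbertSubmodule A E) : HilbertOp A E F where
  toLinearPMap := t.toLinearPMap.domRestrict S.toSubmodule
  op_smul a x := by
    obtain ⟨h1, h2⟩ := t.op_smul a ⟨x, x.2.2⟩
    exact ⟨⟨S.op_smul_mem a x x.2.1, h1⟩, h2⟩

/-- The adjoint of an essentially defined operator: `y ∈ D(t^*)` and `t^* y = z` if and only if
`⟪t x, y⟫ = ⟪x, z⟫` for all `x ∈ D(t)`. -/
noncomputable def adj (t : HilbertOp A E F) : HilbertOp A F E :=
  ofGraph
    { carrier := {p | ∀ x : t.domain, ⟪t.toLinearPMap x, p.1⟫_A = ⟪(x : E), p.2⟫_A}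
      add_mem' := fun {p q} hp hq x => by simp [hp x, hq x]
      zero_mem' := fun x => by simp
      smul_mem' := fun c p hp x => by simp [hp x] }
    (fun a y z h x => by
      have := h x
      simp only [CStarModule.inner_op_smul_right] at this ⊢
      rw [this])

/-- For an essentially defined operator the graph of the adjoint is as expected. -/
theorem mem_gr_adj {t : HilbertOp A E F} (ht : IsEssential A (t.domain : Set E)) {y : F} {z : E} :
    (y, z) ∈ t.adj.gr ↔ ∀ x : t.domain, ⟪t.toLinearPMap x, y⟫_A = ⟪(x : E), z⟫_A := by
  unfold adj
  rw [gr_ofGraph]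
  · rfl
  · rintro ⟨u, v⟩ h (rfl : u = 0)
    have hv : v ∈ ortho A (t.domain : Set E) := fun x hx => by
      have h1 : ⟪x, v⟫_A = 0 := by simpa using (h ⟨x, hx⟩).symm
      rw [← CStarModule.star_inner, h1, star_zero]
    rw [ht] at hv
    exact hv

/-- The graph of `t` as a submodule of the Hilbert `A`-module `E ⊕ F`, whose inner product is
`⟪x.1, y.1⟫ + ⟪x.2, y.2⟫`. -/
noncomputable def hilbertGraph (t : HilbertOp A E F) : Submodule ℂ (WithCStarModule A (E × F)) :=
  t.gr.comap (WithCStarModule.linearEquiv ℂ A (E × F) : WithCStarModule A (E × F) →ₗ[ℂ] E × F)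

/-- `t` is graph regular: it is essentially defined, its graph equals its double orthogonal
complement, and its graph is orthogonally complemented in `E ⊕ F`. -/
structure IsGraphRegular (t : HilbertOp A E F) : Prop where
  essential : IsEssential A (t.domain : Set E)
  orthoClosed : ortho A (ortho A (t.hilbertGraph : Set (WithCStarModule A (E × F))) :
    Set (WithCStarModule A (E × F))) = t.hilbertGraph
  complemented : t.hilbertGraph ⊔
    ortho A (t.hilbertGraph : Set (WithCStarModule A (E × F))) = ⊤

/-- `t` is regular: it is closed, `D(t)` is dense in `E`, `D(t^*)` is dense in `F`, and the range
of `1 + t^* t` is dense in `E`. -/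
structure IsRegular (t : HilbertOp A E F) : Prop where
  closed : t.toLinearPMap.IsClosed
  dense_domain : Dense (t.domain : Set E)
  dense_adj_domain : Dense (t.adj.domain : Set F)
  dense_range : Dense (1 + t.adj.comp t).range

/-- `t` is adjointable: `D(t) = E` and `D(t^*) = F`. -/
structure IsAdjointable (t : HilbertOp A E F) : Prop where
  domain_eq : t.domain = ⊤
  adj_domain_eq : t.adj.domain = ⊤

/-- `s` is a positive square root of `a` among the adjointable operators. -/
structure IsPosSqrt (s a : HilbertOp A E E) : Prop where
  adjointable : s.IsAdjointable
  nonneg : ∀ x : s.domain, 0 ≤ ⟪s.toLinearPMap x, (x : E)⟫_A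
  sq : s.comp s = a

open Classical in
/-- The positive square root `a^{1/2}` of a positive adjointable operator `a`, that is, the unique
positive adjointable operator with square `a` (and the identity if there is none). -/
noncomputable def sqrt (a : HilbertOp A E E) : HilbertOp A E E :=
  if h : ∃ s, IsPosSqrt s a then h.choose else 1

/-- `z` belongs to `𝒵^d(E, F)`: `z` is adjointable, `‖z‖ ≤ 1`, `N(1 - z^* z) = {0}`, and the range
of `1 - z^* z` is dense in `E`. -/
structure IsZd (z : HilbertOp A E F) : Prop where
  adjointable : z.IsAdjointable
  norm_le : ∀ x : z.domain, ‖z.toLinearPMap x‖ ≤ ‖(x : E)‖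
  null_eq : (1 - z.adj.comp z).null = {0}
  dense_range : Dense (1 - z.adj.comp z).range

/-- The operator `t_z` with domain `(1 - z^* z)^{1/2} E` and
`t_z ((1 - z^* z)^{1/2} x) = z x`. -/
noncomputable def ofTransform (z : HilbertOp A E F) : HilbertOp A E F :=
  ofGraph
    { carrier := {p | ∃ x, (x, p.1) ∈ (1 - z.adj.comp z).sqrt.gr ∧ (x, p.2) ∈ z.gr}
      add_mem' := by
        rintro p q ⟨x, h1, h2⟩ ⟨y, h3, h4⟩
        exact ⟨x + y, Submodule.add_mem _ h1 h3, Submodule.add_mem _ h2 h4⟩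
      zero_mem' := ⟨0, Submodule.zero_mem _, Submodule.zero_mem _⟩
      smul_mem' := by
        rintro c p ⟨x, h1, h2⟩
        exact ⟨c • x, Submodule.smul_mem _ c h1, Submodule.smul_mem _ c h2⟩ }
    (by
      rintro a u v ⟨x, h1, h2⟩
      exact ⟨a • x, op_smul_mem_gr _ a h1, op_smul_mem_gr _ a h2⟩)

/-- `a_t = (1 + t^* t)^{-1}`. -/
noncomputable def aTr (t : HilbertOp A E F) : HilbertOp A E E := (1 + t.adj.comp t).inv

/-- `b_t = t (1 + t^* t)^{-1}`. -/
noncomputable def bTr (t : HilbertOp A E F) : HilbertOp A E F := t.comp t.aTr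

/-- The bounded transform `z_t`: the restriction of `t a_t^{1/2}` to the closure of `D(t^* t)`. -/
noncomputable def zTr (t : HilbertOp A E F) : HilbertOp A E F :=
  (t.comp t.aTr.sqrt).restrict (t.adj.comp t).dom.closure

theorem op_smul_mem_between (t : HilbertOp A E F) (E₀ : HilbertSubmodule A E)
    (F₀ : HilbertSubmodule A F) (a : A) (x : E₀.toSubmodule) (y : F₀.toSubmodule)
    (h : (x, y) ∈ t.gr.comap (E₀.toSubmodule.subtype.prodMap F₀.toSubmodule.subtype)) :
    (a • x, a • y) ∈ t.gr.comap (E₀.toSubmodule.subtype.prodMap F₀.toSubmodule.subtype) :=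
  t.op_smul_mem_gr a h

/-- An operator from `E` into `F` seen as an operator from `E₀` into `F₀`; its domain is
`{x ∈ E₀ ∩ D(t) | t x ∈ F₀}`. -/
noncomputable def between (t : HilbertOp A E F) (E₀ : HilbertSubmodule A E)
    (F₀ : HilbertSubmodule A F) : HilbertOp A E₀.toSubmodule F₀.toSubmodule :=
  ofGraph (t.gr.comap (E₀.toSubmodule.subtype.prodMap F₀.toSubmodule.subtype))
    (t.op_smul_mem_between E₀ F₀)

/-- An operator from `E₀` into `F₀` seen as an operator from `E` into `F`, with the same graph. -/
noncomputable def extend {E₀ : HilbertSubmodule A E} {F₀ : HilbertSubmodule A F}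
    (t : HilbertOp A E₀.toSubmodule F₀.toSubmodule) : HilbertOp A E F :=
  ofGraph (t.gr.map (E₀.toSubmodule.subtype.prodMap F₀.toSubmodule.subtype))
    (by
      rintro a x y ⟨⟨u, v⟩, h, h'⟩
      obtain ⟨rfl, rfl⟩ := Prod.ext_iff.mp h'
      exact ⟨(a • u, a • v), t.op_smul_mem_gr a h, rfl⟩)

end

end HilbertOp

end HilbertModule

/-! Write `s` for the adjoint of `t`. Splitting the vectors `(x, 0)` and `(0, y)` along the graph of
`t` and its orthogonal complement shows that `1 + s t` and `1 + t s` are surjective, and the double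
complement condition makes `t` and `s` adjoint to each other. This is the symmetric notion
`IsDualPair`; all later arguments use only it, so each fact about `t` also holds for `s` through
`IsDualPair.symm`. Primes below mark the maps belonging to the mirrored pair.

The resolvent `a = (1 + s t)⁻¹` is everywhere defined, positive and injective, and `b = t a` has the
adjoint `b'`. Let `r` be the positive square root of `a`, found in the C⋆-algebra of adjointable
operators. The identity `⟪b x, b y⟫ = ⟪r x, r y⟫ - ⟪a x, a y⟫` (`inner_b`) makes `r x ↦ b x` a
contraction, which extends to a map `z` on the closure `E₀` of the range of `a`, that is, of the
domain of `s t`. Closedness of `t` gives `t (r x) = z x` (`r_z_mem`), so `z` is the bounded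
transform.

The crucial point is the intertwining relation `b r = r' b` (`b_r`). In the limit it yields `r' z =
b`, hence `z' z = 1 - a` on `E₀` (`z_z`), and it makes `z` and `z'` adjoint to each other
(`inner_z`). The claims on null spaces, closures and adjoints follow because `E₀` and its
counterpart `F₀` are essential, although they need not be the whole modules.

Finally `t_z` has graph `{(r x, z x) | x ∈ E₀}`, which lies in the graph of `t` and contains every
pair `(a x, b x)`. These pairs already determine the adjoint, so `t_z` has adjoint `s` and biadjoint
`t`. -/

namespace HilbertModule

/-! ### Adjointable operators as a C⋆-algebra; positivity and square roots -/

section Adjointable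

variable {A E F : Type*} [NonUnitalCStarAlgebra A] [PartialOrder A] [StarOrderedRing A]
  [NormedAddCommGroup E] [NormedSpace ℂ E] [SMul A E] [CStarModule A E]
  [NormedAddCommGroup F] [NormedSpace ℂ F] [SMul A F] [CStarModule A F]

theorem ext_inner_left {x y : E} (h : ∀ z : E, ⟪x, z⟫_A = ⟪y, z⟫_A) : x = y :=
  ext_inner (A := A) fun z => by rw [← CStarModule.star_inner, h, CStarModule.star_inner]

variable (A) in
theorem continuous_inner_right (x : E) : Continuous fun y : E => ⟪x, y⟫_A :=
  CStarModule.continuous_inner.comp (Continuous.prodMk_right x)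

variable (A) in
theorem continuous_inner_left (y : E) : Continuous fun x : E => ⟪x, y⟫_A :=
  CStarModule.continuous_inner.comp (Continuous.prodMk_left y)

/-- `⟪f x, y⟫ = ⟪x, g y⟫` for all `x` and `y`. -/
def IsAdjointPair (A : Type*) {E F : Type*} [Inner A E] [Inner A F] (f : E → F) (g : F → E) :
    Prop :=
  ∀ x y, inner A (f x) y = inner A x (g y)

theorem IsAdjointPair.symm {f : E → F} {g : F → E} (h : IsAdjointPair A f g) :
    IsAdjointPair A g f := fun y x => by
  rw [← CStarModule.star_inner, ← h, CStarModule.star_inner]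

/-- Linearity over `A` is forced by the inner product, so an adjoint pair always gives a
`HilbertOp`. -/
theorem IsAdjointPair.map_op_smul {f : E → F} {g : F → E} (h : IsAdjointPair A f g) (a : A)
    (x : E) : f (a • x) = a • f x :=
  ext_inner_left (A := A) fun z => by
    rw [h, CStarModule.inner_op_smul_left, CStarModule.inner_op_smul_left, h]

/-- A map with an adjoint is linear. -/
def IsAdjointPair.toLinearMap {f : E → F} {g : F → E} (h : IsAdjointPair A f g) : E →ₗ[ℂ] F where
  toFun := f
  map_add' x y := ext_inner_left (A := A) fun z => by simp [h _ z]
  map_smul' c x := ext_inner_left (A := A) fun z => by simp [h _ z]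

/-- A map with an adjoint is bounded, by the closed graph theorem. -/
noncomputable def IsAdjointPair.toCLM [CompleteSpace E] [CompleteSpace F] {f : E → F} {g : F → E}
    (h : IsAdjointPair A f g) : E →L[ℂ] F where
  toLinearMap := h.toLinearMap
  cont := LinearMap.continuous_of_seq_closed_graph _ fun u x y hu hfu =>
    ext_inner_left (A := A) fun z => by
      have h1 := ((continuous_inner_left A z).tendsto _).comp hfu
      have h2 := ((continuous_inner_left A (g z)).tendsto _).comp hu
      refine (tendsto_nhds_unique h1 (h2.congr fun n => ?_)).trans (h x z).symm
      exact (h _ _).symm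

theorem norm_le_of_inner_le {x : E} {y : F} (h : ⟪x, x⟫_A ≤ ⟪y, y⟫_A) : ‖x‖ ≤ ‖y‖ := by
  rw [CStarModule.norm_eq_sqrt_norm_inner_self (A := A) x,
    CStarModule.norm_eq_sqrt_norm_inner_self (A := A) y]
  exact Real.sqrt_le_sqrt (CStarAlgebra.norm_le_norm_of_nonneg_of_le
    CStarModule.inner_self_nonneg h)

variable (A E) in
/-- The algebra of adjointable operators on a Hilbert module. -/
def adjointable : Subalgebra ℂ (E →L[ℂ] E) where
  carrier := {f | ∃ g : E →L[ℂ] E, IsAdjointPair A f g}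
  mul_mem' := by
    rintro a b ⟨c, hc⟩ ⟨d, hd⟩
    exact ⟨d * c, fun x y => (hc _ _).trans (hd _ _)⟩
  add_mem' := by
    rintro a b ⟨c, hc⟩ ⟨d, hd⟩
    exact ⟨c + d, fun x y => by simp [hc x y, hd x y]⟩
  algebraMap_mem' c := ⟨algebraMap ℂ _ (star c), fun x y => by simp [Algebra.algebraMap_eq_smul_one]⟩

noncomputable instance : Star (adjointable A E) :=
  ⟨fun f => ⟨f.2.choose, f.1, f.2.choose_spec.symm⟩⟩

theorem isAdjointPair_star (f : adjointable A E) :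
    IsAdjointPair A (f : E →L[ℂ] E) (star f : adjointable A E).1 :=
  f.2.choose_spec

theorem star_eq_of_isAdjointPair {f g : adjointable A E} (h : IsAdjointPair A f.1 g.1) :
    star f = g := by
  ext y
  exact ext_inner (A := A) fun x => (isAdjointPair_star f x y).symm.trans (h x y)

noncomputable instance : StarRing (adjointable A E) where
  star_involutive f := star_eq_of_isAdjointPair (isAdjointPair_star f).symm
  star_mul f g := star_eq_of_isAdjointPair fun x y =>
    (isAdjointPair_star f _ _).trans (isAdjointPair_star g _ _)
  star_add f g := star_eq_of_isAdjointPair fun x y => by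
    simp [isAdjointPair_star f x y, isAdjointPair_star g x y]

instance : StarModule ℂ (adjointable A E) where
  star_smul c f := star_eq_of_isAdjointPair fun x y => by
    simp [isAdjointPair_star f x y]

/-- Cauchy–Schwarz applied to `⟪f x, f x⟫ = ⟪x, f^* f x⟫`. -/
theorem norm_mul_self_le_norm_star_mul_self (f : adjointable A E) :
    ‖f‖ * ‖f‖ ≤ ‖star f * f‖ := by
  have h : ‖f‖ ≤ √‖star f * f‖ := by
    refine ContinuousLinearMap.opNorm_le_bound _ (Real.sqrt_nonneg _) fun x => ?_
    have h1 : ‖(f : E →L[ℂ] E) x‖ ^ 2 ≤ ‖star f * f‖ * ‖x‖ ^ 2 := by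
      rw [CStarModule.norm_sq_eq A, isAdjointPair_star f]
      refine (CStarModule.norm_inner_le E).trans ?_
      have := ((star f * f : adjointable A E) : E →L[ℂ] E).le_opNorm x
      calc ‖x‖ * _ ≤ ‖x‖ * (‖star f * f‖ * ‖x‖) := mul_le_mul_of_nonneg_left this (norm_nonneg _)
        _ = _ := by ring
    calc ‖(f : E →L[ℂ] E) x‖ ≤ √(‖star f * f‖ * ‖x‖ ^ 2) := Real.le_sqrt_of_sq_le h1
      _ = √‖star f * f‖ * ‖x‖ := by
        rw [Real.sqrt_mul' _ (sq_nonneg _), Real.sqrt_sq (norm_nonneg x)]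
  calc ‖f‖ * ‖f‖ ≤ √‖star f * f‖ * √‖star f * f‖ :=
        mul_self_le_mul_self (norm_nonneg _) h
    _ = _ := Real.mul_self_sqrt (norm_nonneg _)

instance : CStarRing (adjointable A E) where
  norm_mul_self_le := norm_mul_self_le_norm_star_mul_self

variable (A E) in
-- The involution is isometric, so the adjoints of a convergent sequence form a Cauchy sequence, and
-- their limit is an adjoint of the limit.
theorem isClosed_adjointable [CompleteSpace E] :
    IsClosed (adjointable A E : Set (E →L[ℂ] E)) := by
  refine IsSeqClosed.isClosed fun u f hu hf => ?_
  have hu' : CauchySeq fun n => star (⟨u n, hu n⟩ : adjointable A E) := by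
    have h := hf.cauchySeq
    rw [Metric.cauchySeq_iff'] at h ⊢
    intro ε hε
    obtain ⟨N, hN⟩ := h ε hε
    refine ⟨N, fun n hn => ?_⟩
    have h1 := star_sub (⟨u n, hu n⟩ : adjointable A E) ⟨u N, hu N⟩
    have h2 := norm_star ((⟨u n, hu n⟩ : adjointable A E) - ⟨u N, hu N⟩)
    rw [h1] at h2
    rw [dist_eq_norm]
    refine h2.trans_lt ?_
    have h3 := hN n hn
    rwa [dist_eq_norm] at h3
  have hu2 : CauchySeq fun n => (star (⟨u n, hu n⟩ : adjointable A E)).1 :=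
    hu'.map uniformContinuous_subtype_val
  obtain ⟨g, hg⟩ := cauchySeq_tendsto_of_complete hu2
  refine ⟨g, fun x y => ?_⟩
  have h1 : Filter.Tendsto (fun n => ⟪u n x, y⟫_A) Filter.atTop (nhds ⟪f x, y⟫_A) :=
    ((continuous_inner_left A y).tendsto _).comp
      (((ContinuousLinearMap.apply ℂ E x).continuous.tendsto _).comp hf)
  have h2 : Filter.Tendsto (fun n => ⟪x, (star (⟨u n, hu n⟩ : adjointable A E)).1 y⟫_A)
      Filter.atTop (nhds ⟪x, g y⟫_A) :=
    ((continuous_inner_right A x).tendsto _).comp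
      (((ContinuousLinearMap.apply ℂ E y).continuous.tendsto _).comp hg)
  exact tendsto_nhds_unique h1 (h2.congr fun n => (isAdjointPair_star ⟨u n, hu n⟩ x y).symm)

variable [CompleteSpace E]

instance : CompleteSpace (adjointable A E) :=
  (isClosed_adjointable A E).completeSpace_coe

noncomputable instance : CStarAlgebra (adjointable A E) where

noncomputable instance : PartialOrder (adjointable A E) := CStarAlgebra.spectralOrder _

instance : StarOrderedRing (adjointable A E) := CStarAlgebra.spectralOrderedRing _

variable (A) in
/-- Positivity of an everywhere defined map on a Hilbert module. -/
structure IsPositive (f : E → E) : Prop where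
  symm : IsAdjointPair A f f
  nonneg : ∀ x, 0 ≤ ⟪f x, x⟫_A

/-- A positive map as an adjointable operator. -/
noncomputable def IsPositive.toAdjointable {f : E → E} (hf : IsPositive A f) : adjointable A E :=
  ⟨hf.symm.toCLM, hf.symm.toCLM, hf.symm⟩

theorem isPositive_of_nonneg {f : adjointable A E} (hf : 0 ≤ f) : IsPositive A f.1 := by
  obtain ⟨g, rfl⟩ := CStarAlgebra.nonneg_iff_eq_star_mul_self.mp hf
  have h : ∀ x y, ⟪(star g * g).1 x, y⟫_A = ⟪g.1 x, g.1 y⟫_A := fun x y =>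
    (isAdjointPair_star g).symm _ _
  refine ⟨fun x y => (h x y).trans (isAdjointPair_star g _ _), fun x => ?_⟩
  rw [h]
  exact CStarModule.inner_self_nonneg

theorem apply_eq_zero_of_inner_eq_zero {f : adjointable A E} (hf : 0 ≤ f) {x : E}
    (hx : ⟪f.1 x, x⟫_A = 0) : f.1 x = 0 := by
  have h1 : ∀ y, f.1 y = (CFC.sqrt f).1 ((CFC.sqrt f).1 y) := fun y => by
    conv_lhs => rw [← CFC.sqrt_mul_sqrt_self f hf]
    rfl
  rw [h1, (isPositive_of_nonneg (CFC.sqrt_nonneg f)).symm, CStarModule.inner_self] at hx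
  rw [h1, hx, map_zero]

/-- Since `T T⁻ = -(T⁻)²`, testing the form of `T` on `T⁻ x` gives `⟪T⁻ T⁻ x, T⁻ x⟫ ≤ 0`. Positivity
of `T⁻` gives the reverse inequality, so `T⁻ = 0`. -/
theorem IsPositive.nonneg_toAdjointable {f : E → E} (hf : IsPositive A f) :
    0 ≤ hf.toAdjointable := by
  set T := hf.toAdjointable
  have hT : IsSelfAdjoint T := star_eq_of_isAdjointPair hf.symm
  rw [CStarAlgebra.nonneg_iff_isSelfAdjoint_and_negPart_eq_zero]
  refine ⟨hT, ?_⟩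
  have hN0 : 0 ≤ T⁻ := CFC.negPart_nonneg T
  have hN := isPositive_of_nonneg hN0
  have hTN : T * T⁻ = - (T⁻ * T⁻) := by
    conv_lhs => enter [1]; rw [← CFC.posPart_sub_negPart T hT]
    rw [sub_mul, CFC.posPart_mul_negPart, zero_sub]
  ext x
  have h1 : f (T⁻.1 x) = - T⁻.1 (T⁻.1 x) := congrArg (fun S : adjointable A E => S.1 x) hTN
  have h2 : T⁻.1 (T⁻.1 x) = 0 := by
    refine apply_eq_zero_of_inner_eq_zero hN0 (le_antisymm ?_ (hN.nonneg _))
    have := hf.nonneg (T⁻.1 x)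
    rwa [h1, CStarModule.inner_neg_left, neg_nonneg] at this
  refine CStarModule.inner_self (A := A).mp ?_
  rw [hN.symm, h2, CStarModule.inner_zero_right]

theorem IsPositive.eq_of_comp_self_eq {f g : E → E} (hf : IsPositive A f) (hg : IsPositive A g)
    (h : ∀ x, f (f x) = g (g x)) : f = g := by
  have h1 : hf.toAdjointable * hf.toAdjointable = hg.toAdjointable * hg.toAdjointable := by
    ext x; exact h x
  have h2 : hf.toAdjointable = hg.toAdjointable := by
    rw [← CFC.sqrt_unique h1 hf.nonneg_toAdjointable,
      CFC.sqrt_mul_self _ hg.nonneg_toAdjointable]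
  exact funext fun x => congrArg (fun S : adjointable A E => S.1 x) h2

/-- The root vanishes at `0`, so the square root lies in the non-unital closed subalgebra generated
by `T`. Its approximants have no constant term and map into the range of `f`; this is what later
keeps `r` inside `E₀`. -/
theorem exists_isPositive_sqrt {f : E → E} (hf : IsPositive A f) :
    ∃ g : E → E, IsPositive A g ∧ (∀ x, g (g x) = f x) ∧
      (∀ x, g x ∈ closure (Set.range f)) ∧
      ∀ u v : E → E, IsAdjointPair A u v → (∀ x, u (f x) = f (u x)) →
        ∀ x, u (g x) = g (u x) := by
  set T := hf.toAdjointable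
  have hT0 : 0 ≤ T := hf.nonneg_toAdjointable
  have hT : IsSelfAdjoint T := hT0.isSelfAdjoint
  refine ⟨(CFC.sqrt T).1, isPositive_of_nonneg (CFC.sqrt_nonneg T), fun x => ?_, fun x => ?_,
    fun u v huv hc x => ?_⟩
  · exact congrArg (fun S : adjointable A E => S.1 x) (CFC.sqrt_mul_sqrt_self T hT0)
  · have h1 : CFC.sqrt T ∈ NonUnitalStarAlgebra.elemental ℝ T := by
      rw [CFC.sqrt_eq_real_sqrt T hT0]
      exact cfcₙ_mem_elemental _ _
    -- The claim is carried for `S` and `star S` together, so that the induction step for `star`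
    -- closes.
    have h2 : ∀ S ∈ NonUnitalStarAlgebra.adjoin ℝ {T}, (∀ y, S.1 y ∈ LinearMap.range T.1.toLinearMap)
        ∧ ∀ y, (star S).1 y ∈ LinearMap.range T.1.toLinearMap := by
      intro S hS
      induction hS using NonUnitalStarAlgebra.adjoin_induction with
      | mem S hS =>
        rw [Set.mem_singleton_iff.mp hS, hT.star_eq]
        exact ⟨fun y => ⟨y, rfl⟩, fun y => ⟨y, rfl⟩⟩
      | add S R _ _ hS hR =>
        rw [star_add]
        exact ⟨fun y => add_mem (hS.1 y) (hR.1 y), fun y => add_mem (hS.2 y) (hR.2 y)⟩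
      | zero =>
        rw [star_zero]
        exact ⟨fun y => zero_mem _, fun y => zero_mem _⟩
      | mul S R _ _ hS hR =>
        rw [star_mul]
        exact ⟨fun y => hS.1 _, fun y => hR.2 _⟩
      | smul c S _ hS =>
        rw [star_smul]
        exact ⟨fun y => Submodule.smul_mem _ (c : ℂ) (hS.1 y),
          fun y => Submodule.smul_mem _ (c : ℂ) (hS.2 y)⟩
      | star S _ hS =>
        rw [star_star]
        exact ⟨hS.2, hS.1⟩
    have h3 : Continuous fun S : adjointable A E => S.1 x :=
      (ContinuousLinearMap.apply ℂ E x).continuous.comp continuous_subtype_val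
    exact map_mem_closure (f := fun S : adjointable A E => S.1 x) h3 h1 fun S hS => (h2 S hS).1 x
  · have h1 : Commute T (⟨huv.toCLM, huv.symm.toCLM, huv⟩ : adjointable A E) := by
      ext y; exact (hc y).symm
    have h2 := h1.cfcₙ_nnreal NNReal.sqrt
    exact (congrArg (fun S : adjointable A E => S.1 x) h2).symm

end Adjointable

namespace HilbertOp

/-! ### Calculus of graphs, adjoints and square roots of operators -/

section Graph

variable {A E F G : Type*} [NonUnitalCStarAlgebra A] [PartialOrder A] [StarOrderedRing A]
  [NormedAddCommGroup E] [NormedSpace ℂ E] [SMul A E] [CStarModule A E]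
  [NormedAddCommGroup F] [NormedSpace ℂ F] [SMul A F] [CStarModule A F]
  [NormedAddCommGroup G] [NormedSpace ℂ G] [SMul A G] [CStarModule A G]

theorem ext_gr {s t : HilbertOp A E F} (h : ∀ x y, (x, y) ∈ s.gr ↔ (x, y) ∈ t.gr) : s = t := by
  have h1 : s.toLinearPMap = t.toLinearPMap :=
    LinearPMap.eq_of_eq_graph (Submodule.ext fun p => h p.1 p.2)
  cases s; cases t; congr

theorem le_of_gr_le {s t : HilbertOp A E F} (h : ∀ x y, (x, y) ∈ s.gr → (x, y) ∈ t.gr) : s ≤ t :=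
  LinearPMap.le_of_le_graph fun p hp => h p.1 p.2 hp

theorem gr_unique {t : HilbertOp A E F} {x : E} {y z : F} (hy : (x, y) ∈ t.gr)
    (hz : (x, z) ∈ t.gr) : y = z :=
  LinearPMap.mem_graph_snd_inj _ hy hz rfl

theorem apply_mem_gr (t : HilbertOp A E F) (x : t.domain) : ((x : E), t.toLinearPMap x) ∈ t.gr :=
  t.toLinearPMap.mem_graph x

theorem apply_eq_of_mem_gr {t : HilbertOp A E F} {x : t.domain} {y : F} (h : ((x : E), y) ∈ t.gr) :
    t.toLinearPMap x = y :=
  gr_unique (t.apply_mem_gr x) h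

theorem mem_domain_iff_gr {t : HilbertOp A E F} {x : E} : x ∈ t.domain ↔ ∃ y, (x, y) ∈ t.gr :=
  LinearPMap.mem_domain_iff

theorem mem_domain_of_gr {t : HilbertOp A E F} {x : E} {y : F} (h : (x, y) ∈ t.gr) :
    x ∈ t.domain :=
  mem_domain_iff_gr.mpr ⟨y, h⟩

theorem mem_gr_comp {s : HilbertOp A F G} {t : HilbertOp A E F} {x : E} {z : G} :
    (x, z) ∈ (s.comp t).gr ↔ ∃ y, (x, y) ∈ t.gr ∧ (y, z) ∈ s.gr := by
  unfold comp
  rw [gr_ofGraph]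
  · rfl
  · rintro ⟨u, v⟩ ⟨y, h1, h2⟩ (rfl : u = 0)
    obtain rfl := gr_unique h1 t.gr.zero_mem
    exact gr_unique h2 s.gr.zero_mem

theorem mem_gr_one {x y : E} : (x, y) ∈ (1 : HilbertOp A E E).gr ↔ y = x := by
  constructor
  · intro h
    exact (apply_eq_of_mem_gr (x := ⟨x, mem_domain_of_gr h⟩) h).symm
  · rintro rfl
    exact (1 : HilbertOp A E E).apply_mem_gr ⟨y, trivial⟩

theorem mem_gr_add {s t : HilbertOp A E F} {x : E} {y : F} :
    (x, y) ∈ (s + t).gr ↔ ∃ u v, (x, u) ∈ s.gr ∧ (x, v) ∈ t.gr ∧ y = u + v := by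
  constructor
  · intro h
    have hx : x ∈ s.domain ⊓ t.domain := mem_domain_of_gr h
    exact ⟨_, _, s.apply_mem_gr ⟨x, hx.1⟩, t.apply_mem_gr ⟨x, hx.2⟩,
      (apply_eq_of_mem_gr (t := s + t) (x := ⟨x, hx⟩) h).symm⟩
  · rintro ⟨u, v, hu, hv, rfl⟩
    have hx : x ∈ s.domain ⊓ t.domain := ⟨mem_domain_of_gr hu, mem_domain_of_gr hv⟩
    have := (s + t).apply_mem_gr ⟨x, hx⟩
    rw [← apply_eq_of_mem_gr (x := ⟨x, hx.1⟩) hu, ← apply_eq_of_mem_gr (x := ⟨x, hx.2⟩) hv]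
    exact this

theorem mem_gr_sub {s t : HilbertOp A E F} {x : E} {y : F} :
    (x, y) ∈ (s - t).gr ↔ ∃ u v, (x, u) ∈ s.gr ∧ (x, v) ∈ t.gr ∧ y = u - v := by
  constructor
  · intro h
    have hx : x ∈ s.domain ⊓ t.domain := mem_domain_of_gr h
    exact ⟨_, _, s.apply_mem_gr ⟨x, hx.1⟩, t.apply_mem_gr ⟨x, hx.2⟩,
      (apply_eq_of_mem_gr (t := s - t) (x := ⟨x, hx⟩) h).symm⟩
  · rintro ⟨u, v, hu, hv, rfl⟩
    have hx : x ∈ s.domain ⊓ t.domain := ⟨mem_domain_of_gr hu, mem_domain_of_gr hv⟩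
    have := (s - t).apply_mem_gr ⟨x, hx⟩
    rw [← apply_eq_of_mem_gr (x := ⟨x, hx.1⟩) hu, ← apply_eq_of_mem_gr (x := ⟨x, hx.2⟩) hv]
    exact this

theorem mem_gr_one_add {t : HilbertOp A E E} {x y : E} :
    (x, y) ∈ (1 + t).gr ↔ ∃ v, (x, v) ∈ t.gr ∧ y = x + v := by
  simp [mem_gr_add, mem_gr_one]

theorem mem_gr_one_sub {t : HilbertOp A E E} {x y : E} :
    (x, y) ∈ (1 - t).gr ↔ ∃ v, (x, v) ∈ t.gr ∧ y = x - v := by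
  simp [mem_gr_sub, mem_gr_one]

theorem mem_gr_inv {t : HilbertOp A E F} (ht : ∀ x, (x, 0) ∈ t.gr → x = 0) {x : E} {y : F} :
    (y, x) ∈ t.inv.gr ↔ (x, y) ∈ t.gr := by
  unfold inv
  rw [gr_ofGraph]
  · rfl
  · rintro ⟨u, v⟩ h (rfl : u = 0)
    exact ht v h

theorem mem_gr_restrict {t : HilbertOp A E F} {S : HilbertSubmodule A E} {x : E} {y : F} :
    (x, y) ∈ (t.restrict S).gr ↔ x ∈ S.toSubmodule ∧ (x, y) ∈ t.gr := by
  constructor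
  · intro h
    have hx : x ∈ S.toSubmodule ⊓ t.domain := mem_domain_of_gr h
    refine ⟨hx.1, ?_⟩
    rw [← apply_eq_of_mem_gr (t := t.restrict S) (x := ⟨x, hx⟩) h]
    exact t.apply_mem_gr ⟨x, hx.2⟩
  · rintro ⟨hx, h⟩
    have := (t.restrict S).apply_mem_gr ⟨x, ⟨hx, mem_domain_of_gr h⟩⟩
    rw [← apply_eq_of_mem_gr (x := ⟨x, mem_domain_of_gr h⟩) h]
    exact this

theorem mem_gr_adj_iff {t : HilbertOp A E F} (ht : IsEssential A (t.domain : Set E)) {y : F}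
    {z : E} : (y, z) ∈ t.adj.gr ↔ ∀ u v, (u, v) ∈ t.gr → ⟪v, y⟫_A = ⟪u, z⟫_A := by
  rw [mem_gr_adj ht]
  refine ⟨fun h u v huv => ?_, fun h x => h _ _ (t.apply_mem_gr x)⟩
  have := h ⟨u, mem_domain_of_gr huv⟩
  rwa [apply_eq_of_mem_gr huv] at this

theorem mem_gr_between {t : HilbertOp A E F} {E₀ : HilbertSubmodule A E}
    {F₀ : HilbertSubmodule A F} {x : E₀.toSubmodule} {y : F₀.toSubmodule} :
    (x, y) ∈ (t.between E₀ F₀).gr ↔ ((x : E), (y : F)) ∈ t.gr := by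
  unfold between
  rw [gr_ofGraph]
  · rfl
  · rintro ⟨u, v⟩ h (rfl : u = 0)
    exact Subtype.ext (gr_unique (t := t) h t.gr.zero_mem)

theorem mem_gr_extend {E₀ : HilbertSubmodule A E} {F₀ : HilbertSubmodule A F}
    {t : HilbertOp A E₀.toSubmodule F₀.toSubmodule} {x : E} {y : F} :
    (x, y) ∈ t.extend.gr ↔
      ∃ (hx : x ∈ E₀.toSubmodule) (hy : y ∈ F₀.toSubmodule), (⟨x, hx⟩, ⟨y, hy⟩) ∈ t.gr := by
  unfold extend
  rw [gr_ofGraph]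
  · constructor
    · rintro ⟨⟨u, v⟩, h, h'⟩
      obtain ⟨rfl, rfl⟩ := Prod.ext_iff.mp h'
      exact ⟨u.2, v.2, h⟩
    · rintro ⟨hx, hy, h⟩
      exact ⟨_, h, rfl⟩
  · rintro ⟨u, v⟩ ⟨⟨u', v'⟩, h, h'⟩ (hu : u = 0)
    obtain ⟨h1, h2⟩ := Prod.ext_iff.mp h'
    obtain rfl : u' = 0 := Subtype.ext (h1.trans hu)
    obtain rfl : v' = 0 := gr_unique h t.gr.zero_mem
    exact h2.symm

/-- An everywhere defined map with an everywhere defined adjoint, as an operator. -/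
def ofAdjointPair {f : E → F} {g : F → E} (h : IsAdjointPair A f g) : HilbertOp A E F where
  toLinearPMap := h.toLinearMap.toPMap ⊤
  op_smul a x := ⟨trivial, h.map_op_smul a x⟩

theorem mem_gr_ofAdjointPair {f : E → F} {g : F → E} (h : IsAdjointPair A f g) {x : E} {y : F} :
    (x, y) ∈ (ofAdjointPair h).gr ↔ y = f x := by
  constructor
  · intro hxy
    exact (apply_eq_of_mem_gr (x := ⟨x, mem_domain_of_gr hxy⟩) hxy).symm
  · rintro rfl
    exact (ofAdjointPair h).apply_mem_gr ⟨x, trivial⟩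

theorem eq_ofAdjointPair {t : HilbertOp A E F} {f : E → F} {g : F → E} (h : IsAdjointPair A f g)
    (ht : ∀ x, (x, f x) ∈ t.gr) : t = ofAdjointPair h := by
  refine ext_gr fun x y => ?_
  rw [mem_gr_ofAdjointPair]
  refine ⟨fun hxy => gr_unique hxy (ht x), ?_⟩
  rintro rfl
  exact ht x

variable (A E) in
theorem isEssential_univ : IsEssential A (Set.univ : Set E) :=
  eq_bot_iff.mpr fun x hx => CStarModule.inner_self.mp (hx x trivial)

theorem isEssential_of_dense {S T : Set E} (hS : IsEssential A S) (h : S ⊆ closure T) :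
    IsEssential A T := by
  refine eq_bot_iff.mpr fun x hx => ?_
  rw [← hS]
  intro y hy
  have hcl : IsClosed {y | ⟪x, y⟫_A = 0} :=
    isClosed_eq (continuous_inner_right A x) continuous_const
  exact hcl.closure_subset_iff.mpr (fun y hy => hx y hy) (h hy)

theorem adj_ofAdjointPair {f : E → F} {g : F → E} (h : IsAdjointPair A f g) :
    (ofAdjointPair h).adj = ofAdjointPair h.symm := by
  refine eq_ofAdjointPair _ fun y => ?_
  rw [mem_gr_adj_iff (isEssential_univ A E)]
  intro u v huv
  rw [(mem_gr_ofAdjointPair h).mp huv, h]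

theorem isAdjointable_ofAdjointPair {f : E → F} {g : F → E} (h : IsAdjointPair A f g) :
    (ofAdjointPair h).IsAdjointable where
  domain_eq := rfl
  adj_domain_eq := by rw [adj_ofAdjointPair]; rfl

theorem IsAdjointable.exists_eq_ofAdjointPair {t : HilbertOp A E F} (ht : t.IsAdjointable) :
    ∃ (f : E → F) (g : F → E) (h : IsAdjointPair A f g), t = ofAdjointPair h := by
  have h1 : ∀ x, ∃ y, (x, y) ∈ t.gr := fun x =>
    mem_domain_iff_gr.mp (ht.domain_eq ▸ Submodule.mem_top)
  have h2 : ∀ x, ∃ y, (x, y) ∈ t.adj.gr := fun x =>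
    mem_domain_iff_gr.mp (ht.adj_domain_eq ▸ Submodule.mem_top)
  choose f hf using h1
  choose g hg using h2
  have he : IsEssential A (t.domain : Set E) := by
    rw [ht.domain_eq]; exact isEssential_univ A E
  have h : IsAdjointPair A f g := fun x y => (mem_gr_adj_iff he).mp (hg y) _ _ (hf x)
  exact ⟨f, g, h, eq_ofAdjointPair h hf⟩

/-- A map with an adjoint and a self-adjoint quadratic form is symmetric. -/
theorem isPositive_of_nonneg_inner {f g : E → E} (h : IsAdjointPair A f g)
    (hpos : ∀ x, 0 ≤ ⟪f x, x⟫_A) : IsPositive A f where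
  nonneg := hpos
  symm x y := by
    have hs : ∀ x, ⟪f x, x⟫_A = ⟪x, f x⟫_A := fun x => by
      rw [← CStarModule.star_inner (f x) x, (hpos x).isSelfAdjoint.star_eq]
    have hadd : ∀ x y, f (x + y) = f x + f y := h.toLinearMap.map_add
    have hsmul : ∀ (c : ℂ) x, f (c • x) = c • f x := h.toLinearMap.map_smul
    -- Polarization: `x + y` gives the sum of the mixed terms, `x + i y` their difference.
    have h1 := hs (x + y)
    have h2 := hs (x + Complex.I • y)
    simp only [hadd, hsmul, CStarModule.inner_add_left, CStarModule.inner_add_right,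
      CStarModule.inner_smul_left_complex, CStarModule.inner_smul_right_complex, hs x, hs y,
      Complex.star_def, Complex.conj_I] at h1 h2
    have h3 : ⟪f x, y⟫_A + ⟪f y, x⟫_A = ⟪x, f y⟫_A + ⟪y, f x⟫_A := by
      linear_combination (norm := module) h1
    have h4 : Complex.I • (⟪f x, y⟫_A - ⟪f y, x⟫_A) = Complex.I • (⟪x, f y⟫_A - ⟪y, f x⟫_A) := by
      linear_combination (norm := module) h2
    have h5 : ⟪f x, y⟫_A - ⟪f y, x⟫_A = ⟪x, f y⟫_A - ⟪y, f x⟫_A :=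
      smul_right_injective A Complex.I_ne_zero h4
    have h6 : (2 : ℂ) • ⟪f x, y⟫_A = (2 : ℂ) • ⟪x, f y⟫_A := by
      linear_combination (norm := module) h3 + h5
    exact smul_right_injective A two_ne_zero h6

theorem isPosSqrt_ofAdjointPair {f : E → E} (hf : IsPositive A f) {a : HilbertOp A E E}
    (ha : ∀ x, (x, f (f x)) ∈ a.gr) : IsPosSqrt (ofAdjointPair hf.symm) a where
  adjointable := isAdjointable_ofAdjointPair _
  nonneg x := hf.nonneg x
  sq := by
    refine ext_gr fun x y => ?_
    simp only [mem_gr_comp, mem_gr_ofAdjointPair, exists_eq_left]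
    refine ⟨?_, fun h => gr_unique h (ha x)⟩
    rintro rfl
    exact ha x

theorem IsPosSqrt.exists_isPositive {s a : HilbertOp A E E} (h : IsPosSqrt s a) :
    ∃ (f : E → E) (hf : IsPositive A f), s = ofAdjointPair hf.symm ∧
      ∀ x y, (x, y) ∈ a.gr ↔ y = f (f x) := by
  obtain ⟨f, g, hfg, rfl⟩ := h.adjointable.exists_eq_ofAdjointPair
  have hpos : ∀ x, 0 ≤ ⟪f x, x⟫_A := fun x => h.nonneg ⟨x, trivial⟩
  refine ⟨f, isPositive_of_nonneg_inner hfg hpos, eq_ofAdjointPair _ fun x => (mem_gr_ofAdjointPair _).mpr rfl,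
    fun x y => ?_⟩
  rw [← h.sq, mem_gr_comp]
  simp [mem_gr_ofAdjointPair]

/-- By uniqueness, any positive root exhibited by hand is the one chosen in `sqrt`, and its
existence excludes the default value `1`. -/
theorem sqrt_eq [CompleteSpace E] {f : E → E} (hf : IsPositive A f) {a : HilbertOp A E E}
    (ha : ∀ x, (x, f (f x)) ∈ a.gr) : a.sqrt = ofAdjointPair hf.symm := by
  have hex : ∃ s, IsPosSqrt s a := ⟨_, isPosSqrt_ofAdjointPair hf ha⟩
  rw [sqrt, dif_pos hex]
  obtain ⟨g, hg, hs, h⟩ := hex.choose_spec.exists_isPositive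
  obtain rfl : f = g := hf.eq_of_comp_self_eq hg fun x => (h _ _).mp (ha x)
  exact hs

theorem isEssential_range {f : E → E} (hf : IsAdjointPair A f f) (h0 : ∀ x, f x = 0 → x = 0) :
    IsEssential A (Set.range f) := by
  refine eq_bot_iff.mpr fun x hx => h0 x ?_
  refine ext_inner_left (A := A) fun y => ?_
  rw [hf, hx _ ⟨y, rfl⟩, CStarModule.inner_zero_left]

end Graph

/-! ### Dual pairs: resolvent, its square root and the bounded transform -/

section DualPair

variable {A E F : Type*} [NonUnitalCStarAlgebra A] [PartialOrder A] [StarOrderedRing A]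
  [NormedAddCommGroup E] [NormedSpace ℂ E] [SMul A E] [CStarModule A E]
  [NormedAddCommGroup F] [NormedSpace ℂ F] [SMul A F] [CStarModule A F]

/-- The operators `t` and `s` are adjoint to each other, and `1 + s t` and `1 + t s` are
surjective. -/
structure IsDualPair (t : HilbertOp A E F) (s : HilbertOp A F E) : Prop where
  mem_left : ∀ x y, (x, y) ∈ t.gr ↔ ∀ v u, (v, u) ∈ s.gr → ⟪u, x⟫_A = ⟪v, y⟫_A
  mem_right : ∀ y x, (y, x) ∈ s.gr ↔ ∀ u v, (u, v) ∈ t.gr → ⟪v, y⟫_A = ⟪u, x⟫_A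
  surj_left : ∀ x, ∃ u v, (u, v) ∈ t.gr ∧ (v, x - u) ∈ s.gr
  surj_right : ∀ y, ∃ v u, (v, u) ∈ s.gr ∧ (u, y - v) ∈ t.gr

/-- The complement of the graph is the rotated graph of the adjoint. -/
theorem mem_ortho_hilbertGraph {t : HilbertOp A E F} (ht : IsEssential A (t.domain : Set E))
    {p : WithCStarModule A (E × F)} :
    p ∈ ortho A (t.hilbertGraph : Set (WithCStarModule A (E × F))) ↔ (p.2, -p.1) ∈ t.adj.gr := by
  rw [mem_gr_adj_iff ht]
  have key : ∀ u v, ⟪v, p.2⟫_A = ⟪u, -p.1⟫_A ↔ ⟪p.1, u⟫_A + ⟪p.2, v⟫_A = 0 := fun u v => by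
    rw [CStarModule.inner_neg_right, ← CStarModule.star_inner p.2 v, ← CStarModule.star_inner p.1 u,
      ← star_neg, star_inj, add_comm, add_eq_zero_iff_eq_neg]
  constructor
  · intro hp u v huv
    exact (key u v).mpr (hp ((WithCStarModule.equiv A (E × F)).symm (u, v)) huv)
  · intro hp q hq
    exact (key _ _).mp (hp _ _ hq)

theorem IsGraphRegular.isDualPair {t : HilbertOp A E F} (ht : t.IsGraphRegular) :
    IsDualPair t t.adj := by
  have hdec : ∀ (x : E) (y : F), ∃ u v w z, (u, v) ∈ t.gr ∧ (w, z) ∈ t.adj.gr ∧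
      x = u - z ∧ y = v + w := fun x y => by
    have h : (WithCStarModule.equiv A (E × F)).symm (x, y) ∈ t.hilbertGraph ⊔
        ortho A (t.hilbertGraph : Set (WithCStarModule A (E × F))) := by
      rw [ht.complemented]; trivial
    obtain ⟨p, hp, q, hq, hpq⟩ := Submodule.mem_sup.mp h
    refine ⟨p.1, p.2, q.2, -q.1, hp, (mem_ortho_hilbertGraph ht.essential).mp hq, ?_, ?_⟩
    · rw [sub_neg_eq_add]
      exact (congrArg (fun r : WithCStarModule A (E × F) => r.1) hpq).symm
    · exact (congrArg (fun r : WithCStarModule A (E × F) => r.2) hpq).symm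
  refine ⟨fun x y => ⟨fun h v u hvu => ?_, fun h => ?_⟩, fun y x => mem_gr_adj_iff ht.essential,
    fun x => ?_, fun y => ?_⟩
  · rw [← CStarModule.star_inner, ← CStarModule.star_inner y,
      (mem_gr_adj_iff ht.essential).mp hvu _ _ h]
  · have h1 : (WithCStarModule.equiv A (E × F)).symm (x, y) ∈ ortho A (ortho A
        (t.hilbertGraph : Set (WithCStarModule A (E × F))) :
        Set (WithCStarModule A (E × F))) := by
      intro q hq
      have h2 := h _ _ ((mem_ortho_hilbertGraph ht.essential).mp hq)
      rw [CStarModule.inner_neg_left] at h2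
      change ⟪x, q.1⟫_A + ⟪y, q.2⟫_A = 0
      rw [← CStarModule.star_inner q.1, ← CStarModule.star_inner q.2, ← h2, star_neg,
        add_neg_cancel]
    rw [ht.orthoClosed] at h1
    exact h1
  · obtain ⟨u, v, w, z, huv, hwz, rfl, h0⟩ := hdec x 0
    refine ⟨u, v, huv, ?_⟩
    have := t.adj.gr.neg_mem hwz
    rw [eq_neg_of_add_eq_zero_left h0.symm]
    simpa using this
  · obtain ⟨u, v, w, z, huv, hwz, h0, rfl⟩ := hdec 0 y
    refine ⟨w, z, hwz, ?_⟩
    rw [← sub_eq_zero.mp h0.symm]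
    simpa using huv

namespace IsDualPair

variable {t : HilbertOp A E F} {s : HilbertOp A F E}

theorem symm (h : IsDualPair t s) : IsDualPair s t :=
  ⟨h.mem_right, h.mem_left, h.surj_right, h.surj_left⟩

theorem inner_eq (h : IsDualPair t s) {u : E} {v : F} {y : F} {x : E} (huv : (u, v) ∈ t.gr)
    (hyx : (y, x) ∈ s.gr) : ⟪v, y⟫_A = ⟪u, x⟫_A :=
  (h.mem_right _ _).mp hyx _ _ huv

/-- The resolvent `(1 + s t)⁻¹` as a map. -/
noncomputable def a (h : IsDualPair t s) (x : E) : E := (h.surj_left x).choose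

/-- The map `t (1 + s t)⁻¹`. -/
noncomputable def b (h : IsDualPair t s) (x : E) : F := (h.surj_left x).choose_spec.choose

theorem a_b_mem (h : IsDualPair t s) (x : E) : (h.a x, h.b x) ∈ t.gr :=
  (h.surj_left x).choose_spec.choose_spec.1

theorem b_sub_a_mem (h : IsDualPair t s) (x : E) : (h.b x, x - h.a x) ∈ s.gr :=
  (h.surj_left x).choose_spec.choose_spec.2

theorem eq_zero_of_mem (h : IsDualPair t s) {u : E} {v : F} (h1 : (u, v) ∈ t.gr)
    (h2 : (v, -u) ∈ s.gr) : u = 0 ∧ v = 0 := by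
  have h3 := h.inner_eq h1 h2
  rw [CStarModule.inner_neg_right] at h3
  have h4 : ⟪v, v⟫_A = 0 := le_antisymm
    (h3 ▸ neg_nonpos.mpr CStarModule.inner_self_nonneg) CStarModule.inner_self_nonneg
  rw [h4, eq_comm, neg_eq_zero] at h3
  exact ⟨CStarModule.inner_self.mp h3, CStarModule.inner_self.mp h4⟩

/-- The system `v = t u`, `s v = x - u` has one solution, because a homogeneous solution satisfies
`⟪v, v⟫ = -⟪u, u⟫`. Identities between `a` and `b` are proved by exhibiting solutions. -/
theorem eq_a_b (h : IsDualPair t s) {x u : E} {v : F} (h1 : (u, v) ∈ t.gr)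
    (h2 : (v, x - u) ∈ s.gr) : u = h.a x ∧ v = h.b x := by
  have h3 := t.gr.sub_mem h1 (h.a_b_mem x)
  have h4 := s.gr.sub_mem h2 (h.b_sub_a_mem x)
  have h5 := h.eq_zero_of_mem (u := u - h.a x) (v := v - h.b x) h3 (by simpa using h4)
  exact ⟨sub_eq_zero.mp h5.1, sub_eq_zero.mp h5.2⟩

/-- Split `y = a y + s (b y)` and move `s` across; positivity of `a` can be read off the right-hand
side. -/
theorem inner_a_left (h : IsDualPair t s) (x y : E) :
    ⟪h.a x, y⟫_A = ⟪h.a x, h.a y⟫_A + ⟪h.b x, h.b y⟫_A := by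
  rw [h.inner_eq (h.a_b_mem x) (h.b_sub_a_mem y), ← CStarModule.inner_add_right,
    add_sub_cancel]

theorem isPositive_a (h : IsDualPair t s) : IsPositive A h.a where
  symm x y := by
    rw [← CStarModule.star_inner (h.a y) x, h.inner_a_left, h.inner_a_left y x]
    simp
  nonneg x := by
    rw [h.inner_a_left]
    exact add_nonneg CStarModule.inner_self_nonneg CStarModule.inner_self_nonneg

/-- Pairing `(a x, b x)` with `(a' y, b' y)`, and `(b x, x - a x)` with `(b' y, y - a' y)`, gives
two identities whose unwanted terms cancel. -/
theorem isAdjointPair_b (h : IsDualPair t s) : IsAdjointPair A h.b h.symm.b := fun x y => by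
  have h1 := h.inner_eq (h.a_b_mem x) (h.symm.a_b_mem y)
  have h2 := h.symm.inner_eq (h.b_sub_a_mem x) (h.symm.b_sub_a_mem y)
  rw [CStarModule.inner_sub_left, CStarModule.inner_sub_right] at h2
  rw [h1] at h2
  exact (sub_left_inj.mp h2).symm

theorem eq_zero_of_a_eq_zero (h : IsDualPair t s) {x : E} (hx : h.a x = 0) : x = 0 := by
  have h1 := h.inner_a_left x x
  rw [hx, CStarModule.inner_zero_left, CStarModule.inner_zero_left, zero_add, eq_comm,
    CStarModule.inner_self] at h1
  have h2 := h.b_sub_a_mem x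
  rw [hx, h1, sub_zero] at h2
  exact gr_unique h2 s.gr.zero_mem

/-- Subtracting `(a (a x), b (a x))` from `(a x, b x)` in the graph of `t` shows that `b (a x)` and
`a x - a (a x)` solve the mirrored system with right-hand side `b x`. -/
theorem b_a (h : IsDualPair t s) (x : E) :
    h.b (h.a x) = h.symm.a (h.b x) ∧ h.a x - h.a (h.a x) = h.symm.b (h.b x) := by
  refine h.symm.eq_a_b (h.b_sub_a_mem (h.a x)) ?_
  exact t.gr.sub_mem (h.a_b_mem x) (h.a_b_mem (h.a x))

theorem a_eq_self (h : IsDualPair t s) {x : E} (hx : (x, 0) ∈ t.gr) : h.a x = x :=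
  (h.eq_a_b hx (by rw [sub_self]; exact s.gr.zero_mem)).1.symm

theorem essential_domain (h : IsDualPair t s) : IsEssential A (t.domain : Set E) :=
  isEssential_of_dense (isEssential_range h.isPositive_a.symm fun _ => h.eq_zero_of_a_eq_zero)
    (subset_closure.trans' (Set.range_subset_iff.mpr fun x => mem_domain_of_gr (h.a_b_mem x)))

theorem adj_left (h : IsDualPair t s) : t.adj = s := ext_gr fun y x => by
  rw [mem_gr_adj_iff h.essential_domain, h.mem_right]

theorem mem_gr_adj_comp (h : IsDualPair t s) {x y : E} :
    (x, y) ∈ (s.comp t).gr ↔ x = h.a (x + y) ∧ y = x + y - h.a (x + y) := by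
  rw [mem_gr_comp]
  constructor
  · rintro ⟨v, h1, h2⟩
    have h3 := (h.eq_a_b (x := x + y) h1 (by simpa using h2)).1
    exact ⟨h3, by rw [← h3, add_sub_cancel_left]⟩
  · rintro ⟨h1, h2⟩
    refine ⟨h.b (x + y), ?_, ?_⟩
    · have := h.a_b_mem (x + y)
      rwa [← h1] at this
    · have := h.b_sub_a_mem (x + y)
      rwa [← h2] at this

theorem domain_adj_comp (h : IsDualPair t s) :
    ((s.comp t).domain : Set E) = Set.range h.a := by
  ext x
  rw [SetLike.mem_coe, mem_domain_iff_gr]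
  constructor
  · rintro ⟨y, hy⟩
    exact ⟨x + y, (h.mem_gr_adj_comp.mp hy).1.symm⟩
  · rintro ⟨y, rfl⟩
    exact ⟨y - h.a y, mem_gr_comp.mpr ⟨_, h.a_b_mem y, h.b_sub_a_mem y⟩⟩

theorem coe_closure_dom_adj_comp (h : IsDualPair t s) :
    ((s.comp t).dom.closure.toSubmodule : Set E) = closure (Set.range h.a) := by
  rw [← h.domain_adj_comp]
  exact Submodule.topologicalClosure_coe _

variable [CompleteSpace E] [CompleteSpace F]

/-- The square root of the resolvent. -/
noncomputable def r (h : IsDualPair t s) : E → E :=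
  (exists_isPositive_sqrt h.isPositive_a).choose

theorem isPositive_r (h : IsDualPair t s) : IsPositive A h.r :=
  (exists_isPositive_sqrt h.isPositive_a).choose_spec.1

theorem r_r (h : IsDualPair t s) (x : E) : h.r (h.r x) = h.a x :=
  (exists_isPositive_sqrt h.isPositive_a).choose_spec.2.1 x

theorem r_mem_closure (h : IsDualPair t s) (x : E) : h.r x ∈ closure (Set.range h.a) :=
  (exists_isPositive_sqrt h.isPositive_a).choose_spec.2.2.1 x

theorem eq_zero_of_r_eq_zero (h : IsDualPair t s) {x : E} (hx : h.r x = 0) : x = 0 := by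
  refine h.eq_zero_of_a_eq_zero ?_
  rw [← h.r_r, hx]
  exact h.isPositive_r.symm.toLinearMap.map_zero

theorem continuous_r (h : IsDualPair t s) : Continuous h.r := h.isPositive_r.symm.toCLM.continuous

theorem continuous_b (h : IsDualPair t s) : Continuous h.b := h.isAdjointPair_b.toCLM.continuous

/-- The map `d = b r - r' b` satisfies `r' d = -d r`; hence `d^* d` commutes with `r` and
`⟪d^* d r x, x⟫` is both nonnegative and nonpositive. -/
theorem b_r (h : IsDualPair t s) (x : E) : h.b (h.r x) = h.symm.r (h.b x) := by
  set R : E →L[ℂ] E := h.isPositive_r.symm.toCLM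
  set R' : F →L[ℂ] F := h.symm.isPositive_r.symm.toCLM
  set B : E →L[ℂ] F := h.isAdjointPair_b.toCLM
  set B' : F →L[ℂ] E := h.isAdjointPair_b.symm.toCLM
  have hR : IsPositive A R := h.isPositive_r
  have hR' : IsPositive A R' := h.symm.isPositive_r
  have hB : IsAdjointPair A B B' := h.isAdjointPair_b
  have hRR : ∀ x, R (R x) = h.a x := h.r_r
  have hRR' : ∀ x, R' (R' x) = h.symm.a x := h.symm.r_r
  set d : E → F := fun x => B (R x) - R' (B x)
  set d' : F → E := fun y => R (B' y) - B' (R' y)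
  have hd : IsAdjointPair A d d' := fun x y => by
    simp only [d, d', CStarModule.inner_sub_left, CStarModule.inner_sub_right, hB _ _,
      hR.symm _ _, hR'.symm _ _]
  have hdr : ∀ x, R' (d x) = - d (R x) := fun x => by
    simp only [d, map_sub, hRR, hRR']
    rw [show B (h.a x) = h.symm.a (B x) from (h.b_a x).1]
    abel
  have hdr' : ∀ y, R (d' y) = - d' (R' y) := fun y => by
    refine ext_inner (A := A) fun z => ?_
    rw [← hR.symm, ← hd, CStarModule.inner_neg_right, ← hd, ← hR'.symm, hdr]
    simp
  have hneg' : ∀ y, d' (-y) = - d' y := hd.symm.toLinearMap.map_neg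
  set T : E → E := fun x => d' (d x)
  have hT : IsAdjointPair A T T := fun x y => by
    rw [show T x = d' (d x) from rfl, hd.symm, hd]
  have hTR : ∀ x, T (R x) = R (T x) := fun x => by
    simp only [T]
    rw [hdr', hdr, hneg', neg_neg]
  -- With `q = r^{1/2}`, which commutes with `T = d^* d`, the form `⟪T r x, x⟫` becomes `⟪d q x, d q
  -- x⟫`. This forces `d q = 0`, hence `d a = 0`, and injectivity of `a` then gives `d^* = 0`.
  obtain ⟨q, hq, hqq, -, hqc⟩ := exists_isPositive_sqrt hR
  have hdq : ∀ x, d (q x) = 0 := fun x => by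
    refine CStarModule.inner_self (A := A).mp (le_antisymm ?_ CStarModule.inner_self_nonneg)
    have h1 : ⟪d (q x), d (q x)⟫_A = - ⟪R' (d x), d x⟫_A := by
      rw [hdr, CStarModule.inner_neg_left, neg_neg, hd (R x), ← hqq, hq.symm,
        ← hqc T T hT hTR, hd]
    rw [h1]
    exact neg_nonpos.mpr (hR'.nonneg _)
  have hda : ∀ x, d (h.a x) = 0 := fun x => by
    rw [← hRR, ← hqq]
    exact hdq _
  have hd0 : ∀ y, d' y = 0 := fun y => by
    refine h.eq_zero_of_a_eq_zero (ext_inner (A := A) fun z => ?_)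
    rw [← h.isPositive_a.symm, ← hd, hda]
    simp
  have : d x = 0 := ext_inner_left (A := A) fun y => by
    rw [hd, hd0, CStarModule.inner_zero_right, CStarModule.inner_zero_left]
  exact sub_eq_zero.mp this

theorem inner_b (h : IsDualPair t s) (x y : E) :
    ⟪h.b x, h.b y⟫_A = ⟪h.r x, h.r y⟫_A - ⟪h.a x, h.a y⟫_A := by
  rw [h.isPositive_r.symm, h.r_r, ← h.isPositive_a.symm, h.inner_a_left, add_sub_cancel_left]

theorem norm_b_le (h : IsDualPair t s) (x : E) : ‖h.b x‖ ≤ ‖h.r x‖ := by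
  refine norm_le_of_inner_le (A := A) ?_
  rw [h.inner_b]
  exact sub_le_self _ CStarModule.inner_self_nonneg

theorem a_mem_image_r (h : IsDualPair t s) (x : E) :
    h.a x ∈ h.r '' closure (Set.range h.a) :=
  ⟨h.r x, h.r_mem_closure x, h.r_r x⟩

theorem closure_range_a_subset (h : IsDualPair t s) :
    closure (Set.range h.a) ⊆ closure (h.r '' closure (Set.range h.a)) :=
  closure_mono (Set.range_subset_iff.mpr h.a_mem_image_r)

theorem b_mem_closure (h : IsDualPair t s) {x : E} (hx : x ∈ closure (Set.range h.a)) :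
    h.b x ∈ closure (Set.range h.symm.a) := by
  refine map_mem_closure h.continuous_b hx ?_
  rintro _ ⟨y, rfl⟩
  exact ⟨_, (h.b_a y).1.symm⟩

theorem mem_gr_of_tendsto (h : IsDualPair t s) {u : ℕ → E} {v : ℕ → F} {x : E} {y : F}
    (huv : ∀ n, (u n, v n) ∈ t.gr) (hu : Filter.Tendsto u Filter.atTop (nhds x))
    (hv : Filter.Tendsto v Filter.atTop (nhds y)) : (x, y) ∈ t.gr :=
  (h.mem_left x y).mpr fun w z hwz => tendsto_nhds_unique
    ((((continuous_inner_right A z).tendsto _).comp hu).congr fun n =>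
      h.symm.inner_eq hwz (huv n))
    (((continuous_inner_right A w).tendsto _).comp hv)

/-- By `norm_b_le`, `b (u n)` is Cauchy as soon as `r (u n)` converges. Choosing the `u n` in `E₀`
lets `b_mem_closure` place the limit in `F₀`. -/
theorem exists_z (h : IsDualPair t s) {x : E} (hx : x ∈ closure (Set.range h.a)) :
    ∃ (y : F) (u : ℕ → E), (∀ n, u n ∈ closure (Set.range h.a)) ∧
      Filter.Tendsto (fun n => h.r (u n)) Filter.atTop (nhds x) ∧
      Filter.Tendsto (fun n => h.b (u n)) Filter.atTop (nhds y) := by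
  obtain ⟨w, hw, hwx⟩ := mem_closure_iff_seq_limit.mp (h.closure_range_a_subset hx)
  choose u hu huw using hw
  obtain rfl : (fun n => h.r (u n)) = w := funext huw
  have hc : CauchySeq fun n => h.b (u n) := by
    have hc := hwx.cauchySeq
    rw [Metric.cauchySeq_iff'] at hc ⊢
    intro ε hε
    obtain ⟨N, hN⟩ := hc ε hε
    refine ⟨N, fun n hn => lt_of_le_of_lt ?_ (hN n hn)⟩
    rw [dist_eq_norm, dist_eq_norm]
    have h1 := h.norm_b_le (u n - u N)
    rwa [show h.b (u n - u N) = h.b (u n) - h.b (u N) from h.isAdjointPair_b.toLinearMap.map_sub _ _,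
      show h.r (u n - u N) = h.r (u n) - h.r (u N) from h.isPositive_r.symm.toLinearMap.map_sub _ _]
      at h1
  obtain ⟨y, hy⟩ := cauchySeq_tendsto_of_complete hc
  exact ⟨y, u, hu, hwx, hy⟩

/-- The bounded transform `t (1 + s t)^{-1/2}` on the closure of the domain of `s t`. -/
noncomputable def z (h : IsDualPair t s) (x : closure (Set.range h.a)) : F :=
  (h.exists_z x.2).choose

theorem z_spec (h : IsDualPair t s) (x : closure (Set.range h.a)) :
    ∃ u : ℕ → E, (∀ n, u n ∈ closure (Set.range h.a)) ∧
      Filter.Tendsto (fun n => h.r (u n)) Filter.atTop (nhds (x : E)) ∧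
      Filter.Tendsto (fun n => h.b (u n)) Filter.atTop (nhds (h.z x)) :=
  (h.exists_z x.2).choose_spec

/-- Limit of the pairs `(r (r (u n)), b (u n))` in the closed graph of `t`. It pins down `z x` as `t
(r x)`, so the chosen sequence is irrelevant. -/
theorem r_z_mem (h : IsDualPair t s) (x : closure (Set.range h.a)) :
    (h.r x, h.z x) ∈ t.gr := by
  obtain ⟨u, -, h1, h2⟩ := h.z_spec x
  refine h.mem_gr_of_tendsto (fun n => h.a_b_mem (u n)) ?_ h2
  simp_rw [← h.r_r]
  exact (h.continuous_r.tendsto _).comp h1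

theorem z_eq (h : IsDualPair t s) {x : closure (Set.range h.a)} {y : F}
    (hy : (h.r x, y) ∈ t.gr) : h.z x = y :=
  gr_unique (h.r_z_mem x) hy

theorem z_mem (h : IsDualPair t s) (x : closure (Set.range h.a)) :
    h.z x ∈ closure (Set.range h.symm.a) := by
  obtain ⟨u, hu, -, h2⟩ := h.z_spec x
  exact isClosed_closure.mem_of_tendsto h2 (.of_forall fun n => h.b_mem_closure (hu n))

theorem z_r (h : IsDualPair t s) (x : E) : h.z ⟨h.r x, h.r_mem_closure x⟩ = h.b x :=
  h.z_eq (by simpa only [h.r_r] using h.a_b_mem x)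

theorem r_z (h : IsDualPair t s) (x : closure (Set.range h.a)) : h.symm.r (h.z x) = h.b x := by
  obtain ⟨u, -, h1, h2⟩ := h.z_spec x
  refine tendsto_nhds_unique ((h.symm.continuous_r.tendsto _).comp h2) ?_
  refine ((h.continuous_b.tendsto _).comp h1).congr fun n => ?_
  exact h.b_r (u n)

/-- As `r' (z x) = b x`, the value of the mirrored transform at `z x` is `s (b x) = x - a x`. -/
theorem z_z (h : IsDualPair t s) (x : closure (Set.range h.a)) :
    h.symm.z ⟨h.z x, h.z_mem x⟩ = x - h.a x :=
  h.symm.z_eq (by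
    change (h.symm.r (h.z x), _) ∈ _
    rw [h.r_z]
    exact h.b_sub_a_mem x)

/-- On approximants this is `⟪b u, r' v⟫ = ⟪r' b u, v⟫ = ⟪b r u, v⟫ = ⟪r u, b' v⟫`. -/
theorem inner_z (h : IsDualPair t s) (x : closure (Set.range h.a))
    (y : closure (Set.range h.symm.a)) : ⟪h.z x, (y : F)⟫_A = ⟪(x : E), h.symm.z y⟫_A := by
  obtain ⟨u, -, h1, h2⟩ := h.z_spec x
  obtain ⟨v, -, h3, h4⟩ := h.symm.z_spec y
  have h5 := (CStarModule.continuous_inner (A := A).tendsto _).comp (h2.prodMk_nhds h3)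
  have h6 := (CStarModule.continuous_inner (A := A).tendsto _).comp (h1.prodMk_nhds h4)
  refine tendsto_nhds_unique (h5.congr fun n => ?_) h6
  simp only [Function.comp]
  rw [← h.symm.isPositive_r.symm, ← h.b_r, h.isAdjointPair_b]

theorem norm_z_le (h : IsDualPair t s) (x : closure (Set.range h.a)) : ‖h.z x‖ ≤ ‖(x : E)‖ := by
  obtain ⟨u, -, h1, h2⟩ := h.z_spec x
  exact le_of_tendsto_of_tendsto h2.norm h1.norm (.of_forall fun n => h.norm_b_le (u n))

end IsDualPair

end DualPair

/-! ### The operators of the theorem in terms of `a`, `b`, `r` and `z` -/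

namespace IsDualPair

variable {A E F : Type*} [NonUnitalCStarAlgebra A] [PartialOrder A] [StarOrderedRing A]
  [NormedAddCommGroup E] [NormedSpace ℂ E] [CompleteSpace E] [SMul A E] [CStarModule A E]
  [NormedAddCommGroup F] [NormedSpace ℂ F] [CompleteSpace F] [SMul A F] [CStarModule A F]
  {t : HilbertOp A E F} {s : HilbertOp A F E}

theorem aTr_eq (h : IsDualPair t s) : t.aTr = ofAdjointPair h.isPositive_a.symm := by
  have h1 : ∀ x y, (x, y) ∈ (1 + s.comp t).gr ↔ x = h.a y := fun x y => by
    rw [mem_gr_one_add]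
    constructor
    · rintro ⟨v, hv, rfl⟩
      exact (h.mem_gr_adj_comp.mp hv).1
    · rintro rfl
      exact ⟨y - h.a y, mem_gr_comp.mpr ⟨_, h.a_b_mem y, h.b_sub_a_mem y⟩, by abel⟩
  refine ext_gr fun x y => ?_
  rw [aTr, h.adj_left, mem_gr_inv, h1, mem_gr_ofAdjointPair]
  intro x hx
  rw [h1] at hx
  rw [hx]
  exact h.isPositive_a.symm.toLinearMap.map_zero

theorem aTr_sqrt_eq (h : IsDualPair t s) : t.aTr.sqrt = ofAdjointPair h.isPositive_r.symm :=
  sqrt_eq h.isPositive_r fun x => by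
    rw [h.aTr_eq, mem_gr_ofAdjointPair, h.r_r]

theorem mem_gr_zTr (h : IsDualPair t s) {x : E} {y : F} :
    (x, y) ∈ t.zTr.gr ↔ ∃ hx : x ∈ closure (Set.range h.a), y = h.z ⟨x, hx⟩ := by
  rw [zTr, h.adj_left, mem_gr_restrict, mem_gr_comp, h.aTr_sqrt_eq]
  simp only [mem_gr_ofAdjointPair, exists_eq_left]
  rw [← SetLike.mem_coe, h.coe_closure_dom_adj_comp]
  constructor
  · rintro ⟨hx, hy⟩
    exact ⟨hx, (h.z_eq (x := ⟨x, hx⟩) hy).symm⟩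
  · rintro ⟨hx, rfl⟩
    exact ⟨hx, h.r_z_mem ⟨x, hx⟩⟩

theorem mem_gr_sqrt_comp (h : IsDualPair t s) {x : E} {y : F} :
    (x, y) ∈ (s.aTr.sqrt.comp t).gr ↔ ∃ v, (x, v) ∈ t.gr ∧ y = h.symm.r v := by
  rw [mem_gr_comp, h.symm.aTr_sqrt_eq]
  simp only [mem_gr_ofAdjointPair]

theorem mem_gr_one_sub_comp (h : IsDualPair t s) {x y : E} :
    (x, y) ∈ (1 - s.zTr.comp t.zTr).gr ↔ x ∈ closure (Set.range h.a) ∧ y = h.a x := by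
  simp only [mem_gr_one_sub, mem_gr_comp, h.mem_gr_zTr, h.symm.mem_gr_zTr]
  constructor
  · rintro ⟨_, ⟨_, ⟨hx, rfl⟩, ⟨_, rfl⟩⟩, rfl⟩
    refine ⟨hx, ?_⟩
    rw [h.z_z ⟨x, hx⟩, sub_sub_cancel]
  · rintro ⟨hx, rfl⟩
    exact ⟨_, ⟨_, ⟨hx, rfl⟩, ⟨h.z_mem _, rfl⟩⟩, by rw [h.z_z ⟨x, hx⟩, sub_sub_cancel]⟩

theorem isEssential_closure (h : IsDualPair t s) : IsEssential A (closure (Set.range h.a)) :=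
  isEssential_of_dense (isEssential_range h.isPositive_a.symm fun _ => h.eq_zero_of_a_eq_zero)
    (subset_closure.trans subset_closure)

/-- By `z_z`, `1 - z' z` is the restriction of the symmetric map `a` to the essential submodule
`E₀`, so its adjoint extends the everywhere defined `a` and equals it. -/
theorem aTr_eq_adj (h : IsDualPair t s) : t.aTr = (1 - s.zTr.comp t.zTr).adj := by
  have hdom : ((1 - s.zTr.comp t.zTr).domain : Set E) = closure (Set.range h.a) := by
    ext x
    rw [SetLike.mem_coe, mem_domain_iff_gr]
    simp [h.mem_gr_one_sub_comp]
  have hess : IsEssential A ((1 - s.zTr.comp t.zTr).domain : Set E) :=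
    hdom ▸ h.isEssential_closure
  rw [h.aTr_eq]
  refine (eq_ofAdjointPair _ fun x => ?_).symm
  rw [mem_gr_adj_iff hess]
  intro u v huv
  rw [(h.mem_gr_one_sub_comp.mp huv).2, h.isPositive_a.symm]

theorem bTr_eq (h : IsDualPair t s) : t.bTr = t.zTr.comp t.aTr.sqrt := by
  rw [bTr, h.aTr_sqrt_eq, h.aTr_eq]
  refine ext_gr fun x y => ?_
  simp only [mem_gr_comp, mem_gr_ofAdjointPair, exists_eq_left, h.mem_gr_zTr]
  constructor
  · intro hy
    exact ⟨h.r_mem_closure x, by rw [h.z_r]; exact gr_unique hy (h.a_b_mem x)⟩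
  · rintro ⟨_, rfl⟩
    rw [h.z_r]
    exact h.a_b_mem x

theorem domain_zTr (h : IsDualPair t s) : (t.zTr.domain : Set E) = closure (Set.range h.a) := by
  ext x
  rw [SetLike.mem_coe, mem_domain_iff_gr]
  simp [h.mem_gr_zTr]

/-- Otherwise `r x - x` would be an eigenvector of the positive map `r` for the eigenvalue `-1`. -/
theorem r_eq_self (h : IsDualPair t s) {x : E} (hx : h.a x = x) : h.r x = x := by
  have hadd : ∀ u v, h.r (u + v) = h.r u + h.r v := h.isPositive_r.symm.toLinearMap.map_add
  have hsub : ∀ u v, h.r (u - v) = h.r u - h.r v := h.isPositive_r.symm.toLinearMap.map_sub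
  have h1 : h.r (h.r x - x) = -(h.r x - x) := by
    rw [hsub, h.r_r, hx, neg_sub]
  have h2 := h.isPositive_r.nonneg (h.r x - x)
  rw [h1, CStarModule.inner_neg_left, neg_nonneg] at h2
  exact sub_eq_zero.mp (CStarModule.inner_self.mp (le_antisymm h2 CStarModule.inner_self_nonneg))

/-- If `z x = 0`, then `b x = r' (z x) = 0` and `x - a x = s 0 = 0`. If `t x = 0`, then `a` and `r`
fix `x`, so `z x = t (r x) = 0`. -/
theorem null_zTr (h : IsDualPair t s) : t.zTr.null = t.null := by
  ext x
  change (x, 0) ∈ t.zTr.gr ↔ (x, 0) ∈ t.gr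
  rw [h.mem_gr_zTr]
  constructor
  · rintro ⟨hx, h0⟩
    have h1 : h.b x = 0 := by
      rw [← h.r_z ⟨x, hx⟩, ← h0]
      exact h.symm.isPositive_r.symm.toLinearMap.map_zero
    have h2 := h.b_sub_a_mem x
    rw [h1] at h2
    have h3 : x = h.a x := sub_eq_zero.mp (gr_unique h2 s.gr.zero_mem)
    have h4 := h.a_b_mem x
    rwa [← h3, h1] at h4
  · intro h0
    have h1 := h.a_eq_self h0
    refine ⟨subset_closure ⟨x, h1⟩, (h.z_eq ?_).symm⟩
    rw [h.r_eq_self h1]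
    exact h0

theorem range_zTr (h : IsDualPair t s) : t.zTr.range ⊆ t.range := by
  rintro y ⟨x, hx⟩
  obtain ⟨hx, rfl⟩ := h.mem_gr_zTr.mp hx
  exact ⟨_, h.r_z_mem _⟩

/-- Passing to the closure of the graph of `a_{t^*}^{1/2} t`, pairings with `F₀` are governed by
`z_{t^*}`. -/
theorem inner_of_mem_closure (h : IsDualPair t s) {x : E} {w : F}
    (hxw : (x, w) ∈ (s.aTr.sqrt.comp t).gr.topologicalClosure)
    (y : closure (Set.range h.symm.a)) : ⟪w, (y : F)⟫_A = ⟪x, h.symm.z y⟫_A := by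
  have hcl : IsClosed {p : E × F | ⟪p.2, (y : F)⟫_A = ⟪p.1, h.symm.z y⟫_A} :=
    isClosed_eq ((continuous_inner_left A _).comp continuous_snd)
      ((continuous_inner_left A _).comp continuous_fst)
  refine hcl.closure_subset_iff.mpr ?_ hxw
  rintro ⟨u, v⟩ huv
  obtain ⟨v, hv, rfl⟩ := h.mem_gr_sqrt_comp.mp huv
  change ⟪h.symm.r v, (y : F)⟫_A = _
  rw [h.symm.isPositive_r.symm]
  exact h.inner_eq hv (h.symm.r_z_mem y)

theorem eq_of_inner_closure (h : IsDualPair t s) {v w : E}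
    (hvw : ∀ y : closure (Set.range h.a), ⟪v, (y : E)⟫_A = ⟪w, (y : E)⟫_A) : v = w := by
  have h1 : v - w ∈ ortho A (closure (Set.range h.a)) := fun y hy => by
    rw [CStarModule.inner_sub_left, hvw ⟨y, hy⟩, sub_self]
  rw [h.isEssential_closure] at h1
  exact sub_eq_zero.mp h1

/-- If `(0, w)` is in the closure of the graph, then `w` is orthogonal to the essential set `F₀`. -/
theorem isClosable_sqrt_comp (h : IsDualPair t s) :
    (s.aTr.sqrt.comp t).toLinearPMap.IsClosable := by
  refine ⟨_, (Submodule.toLinearPMap_graph_eq _ ?_).symm⟩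
  rintro ⟨u, v⟩ huv (rfl : u = 0)
  refine h.symm.eq_of_inner_closure fun y => ?_
  rw [h.inner_of_mem_closure huv]
  simp

theorem mem_graph_domRestrict {f : E →ₗ.[ℂ] F} {S : Submodule ℂ E} {x : E} {y : F} :
    (x, y) ∈ (f.domRestrict S).graph ↔ x ∈ S ∧ (x, y) ∈ f.graph := by
  constructor
  · intro h
    exact ⟨(LinearPMap.mem_domain_of_mem_graph h).1,
      LinearPMap.le_graph_of_le LinearPMap.domRestrict_le h⟩
  · rintro ⟨hx, h⟩
    have h1 := (f.domRestrict S).mem_graph ⟨x, hx, LinearPMap.mem_domain_of_mem_graph h⟩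
    have h2 := LinearPMap.le_graph_of_le LinearPMap.domRestrict_le h1
    rwa [LinearPMap.mem_graph_snd_inj _ h2 h rfl] at h1

theorem zTr_eq_closure (h : IsDualPair t s) {E₀ : HilbertSubmodule A E}
    (hE : (E₀.toSubmodule : Set E) = closure (Set.range h.a)) :
    t.zTr.toLinearPMap =
      (s.aTr.sqrt.comp t).toLinearPMap.closure.domRestrict E₀.toSubmodule := by
  have hgr := h.isClosable_sqrt_comp.graph_closure_eq_closure_graph
  set f := (s.aTr.sqrt.comp t).toLinearPMap.closure
  have hmem : ∀ x : closure (Set.range h.a), ((x : E), h.z x) ∈ f.graph := fun x => by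
    rw [← hgr]
    obtain ⟨u, hu, h1, h2⟩ := h.z_spec x
    refine mem_closure_of_tendsto (h1.prodMk_nhds h2) (.of_forall fun n => ?_)
    -- The approximants `(r u, b u)` lie in the graph of `r' t`, since `t (r u) = z u` and `r' (z u)
    -- = b u`.
    exact h.mem_gr_sqrt_comp.mpr ⟨_, h.r_z_mem ⟨u n, hu n⟩, (h.r_z ⟨u n, hu n⟩).symm⟩
  refine LinearPMap.eq_of_eq_graph (Submodule.ext fun ⟨x, y⟩ => ?_)
  rw [mem_graph_domRestrict, ← SetLike.mem_coe (p := E₀.toSubmodule), hE]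
  refine h.mem_gr_zTr.trans ⟨?_, fun ⟨hx, hxy⟩ => ⟨hx, ?_⟩⟩
  · rintro ⟨hx, rfl⟩
    exact ⟨hx, hmem ⟨x, hx⟩⟩
  · exact LinearPMap.mem_graph_snd_inj _ hxy (hmem ⟨x, hx⟩) rfl

/-! ### The transform from `E₀` to `F₀` and the regular operator `t_z` -/

section Between

variable {E₀ : HilbertSubmodule A E} {F₀ : HilbertSubmodule A F}

/-- The square root of the resolvent as a map on the closure of the domain of `s t`. -/
noncomputable def r₀ (h : IsDualPair t s)
    (hE : (E₀.toSubmodule : Set E) = closure (Set.range h.a)) (x : E₀.toSubmodule) :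
    E₀.toSubmodule :=
  ⟨h.r x, hE.ge (h.r_mem_closure x)⟩

/-- The bounded transform as a map between the closures of the domains of `s t` and `t s`. -/
noncomputable def z₀ (h : IsDualPair t s)
    (hE : (E₀.toSubmodule : Set E) = closure (Set.range h.a))
    (hF : (F₀.toSubmodule : Set F) = closure (Set.range h.symm.a)) (x : E₀.toSubmodule) :
    F₀.toSubmodule :=
  ⟨h.z ⟨x, hE.le x.2⟩, hF.ge (h.z_mem _)⟩

variable (h : IsDualPair t s) (hE : (E₀.toSubmodule : Set E) = closure (Set.range h.a))
  (hF : (F₀.toSubmodule : Set F) = closure (Set.range h.symm.a))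

include h hE

theorem isPositive_r₀ : IsPositive A (h.r₀ hE) where
  symm x y := h.isPositive_r.symm x y
  nonneg x := h.isPositive_r.nonneg x

theorem dense_range_r₀ : Dense (Set.range (h.r₀ hE)) := by
  rw [Subtype.dense_iff]
  intro x hx
  have hx' : x ∈ closure (Set.range h.a) := hE.le hx
  refine closure_mono ?_ (h.closure_range_a_subset hx')
  rintro _ ⟨y, hy, rfl⟩
  exact ⟨_, ⟨⟨y, hE.ge hy⟩, rfl⟩, rfl⟩

theorem r₀_injective {x : E₀.toSubmodule} (hx : h.r₀ hE x = 0) : x = 0 :=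
  Subtype.ext (h.eq_zero_of_r_eq_zero (congrArg Subtype.val hx))

include hF

theorem isAdjointPair_z₀ : IsAdjointPair A (h.z₀ hE hF) (h.symm.z₀ hF hE) := fun x y =>
  h.inner_z ⟨x, hE.le x.2⟩ ⟨y, hF.le y.2⟩

theorem zTr_between_eq : t.zTr.between E₀ F₀ = ofAdjointPair (h.isAdjointPair_z₀ hE hF) :=
  eq_ofAdjointPair _ fun x => mem_gr_between.mpr (h.mem_gr_zTr.mpr ⟨hE.le x.2, rfl⟩)

theorem z₀_z₀ (x : E₀.toSubmodule) :
    h.symm.z₀ hF hE (h.z₀ hE hF x) = x - h.r₀ hE (h.r₀ hE x) :=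
  Subtype.ext ((h.z_z ⟨x, hE.le x.2⟩).trans (congrArg _ (h.r_r x).symm))

theorem mem_gr_one_sub_adj_comp {x y : E₀.toSubmodule} :
    (x, y) ∈ (1 - (ofAdjointPair (h.isAdjointPair_z₀ hE hF)).adj.comp
      (ofAdjointPair (h.isAdjointPair_z₀ hE hF))).gr ↔ y = h.r₀ hE (h.r₀ hE x) := by
  simp [adj_ofAdjointPair, mem_gr_one_sub, mem_gr_comp, mem_gr_ofAdjointPair, h.z₀_z₀ hE hF]

theorem dense_range_r₀_r₀ : Dense (Set.range fun x => h.r₀ hE (h.r₀ hE x)) := by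
  have hc : Continuous (h.r₀ hE) :=
    (h.continuous_r.comp continuous_subtype_val).subtype_mk _
  exact (DenseRange.comp (g := h.r₀ hE) (h.dense_range_r₀ hE) (h.dense_range_r₀ hE) hc)

theorem isZd_z₀ : (ofAdjointPair (h.isAdjointPair_z₀ hE hF)).IsZd where
  adjointable := isAdjointable_ofAdjointPair _
  norm_le x := h.norm_z_le ⟨x.1, hE.le x.1.2⟩
  null_eq := by
    ext x
    refine (h.mem_gr_one_sub_adj_comp hE hF).trans ⟨fun hx => ?_, ?_⟩
    · exact h.r₀_injective hE (h.r₀_injective hE hx.symm)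
    · rintro rfl
      have h0 : h.r₀ hE 0 = 0 := (h.isPositive_r₀ hE).symm.toLinearMap.map_zero
      rw [h0, h0]
  dense_range := by
    refine (congrArg Dense (Set.ext fun y => ?_)).mpr (h.dense_range_r₀_r₀ hE hF)
    exact exists_congr fun x => (h.mem_gr_one_sub_adj_comp hE hF).trans eq_comm

/-- On `E₀` one has `1 - z^* z = r r`, so the root in the definition is `r`; its injectivity makes
the relation single-valued. -/
theorem mem_gr_ofTransform {u : E₀.toSubmodule} {v : F₀.toSubmodule} :
    (u, v) ∈ (ofAdjointPair (h.isAdjointPair_z₀ hE hF)).ofTransform.gr ↔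
      ∃ x, u = h.r₀ hE x ∧ v = h.z₀ hE hF x := by
  have : CompleteSpace E₀.toSubmodule :=
    (hE ▸ isClosed_closure : IsClosed (E₀.toSubmodule : Set E)).completeSpace_coe
  have hs : (1 - (ofAdjointPair (h.isAdjointPair_z₀ hE hF)).adj.comp
      (ofAdjointPair (h.isAdjointPair_z₀ hE hF))).sqrt =
        ofAdjointPair (h.isPositive_r₀ hE).symm :=
    sqrt_eq (h.isPositive_r₀ hE) fun x => (h.mem_gr_one_sub_adj_comp hE hF).mpr rfl
  unfold ofTransform
  rw [gr_ofGraph]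
  · refine exists_congr fun x => ?_
    rw [hs, mem_gr_ofAdjointPair, mem_gr_ofAdjointPair]
  · rintro ⟨u, v⟩ ⟨x, h1, h2⟩ (rfl : u = 0)
    rw [hs, mem_gr_ofAdjointPair] at h1
    rw [mem_gr_ofAdjointPair, h.r₀_injective hE h1.symm] at h2
    exact h2.trans (h.isAdjointPair_z₀ hE hF).toLinearMap.map_zero

theorem mem_gr_of_mem_gr_ofTransform {u : E₀.toSubmodule} {v : F₀.toSubmodule}
    (huv : (u, v) ∈ (ofAdjointPair (h.isAdjointPair_z₀ hE hF)).ofTransform.gr) :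
    ((u : E), (v : F)) ∈ t.gr := by
  obtain ⟨x, rfl, rfl⟩ := (h.mem_gr_ofTransform hE hF).mp huv
  exact h.r_z_mem ⟨x, hE.le x.2⟩

theorem dense_domain_ofTransform :
    Dense ((ofAdjointPair (h.isAdjointPair_z₀ hE hF)).ofTransform.domain : Set E₀.toSubmodule) := by
  refine (h.dense_range_r₀ hE).mono (Set.range_subset_iff.mpr fun x => ?_)
  exact mem_domain_of_gr ((h.mem_gr_ofTransform hE hF).mpr ⟨x, rfl, rfl⟩)

theorem mem_gr_adj_ofTransform {y : F₀.toSubmodule} {x : E₀.toSubmodule}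
    (hyx : ((y : F), (x : E)) ∈ s.gr) :
    (y, x) ∈ (ofAdjointPair (h.isAdjointPair_z₀ hE hF)).ofTransform.adj.gr := by
  rw [mem_gr_adj_iff (isEssential_of_dense (isEssential_univ A _)
    (h.dense_domain_ofTransform hE hF).closure_eq.ge)]
  exact fun u v huv => h.inner_eq (h.mem_gr_of_mem_gr_ofTransform hE hF huv) hyx

theorem isClosed_ofTransform :
    (ofAdjointPair (h.isAdjointPair_z₀ hE hF)).ofTransform.toLinearPMap.IsClosed := by
  have : CompleteSpace E₀.toSubmodule :=
    (hE ▸ isClosed_closure : IsClosed (E₀.toSubmodule : Set E)).completeSpace_coe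
  have : CompleteSpace F₀.toSubmodule :=
    (hF ▸ isClosed_closure : IsClosed (F₀.toSubmodule : Set F)).completeSpace_coe
  have hr := (h.isPositive_r₀ hE).symm.toCLM.continuous
  have hz := (h.isAdjointPair_z₀ hE hF).toCLM.continuous
  have hz' := (h.isAdjointPair_z₀ hE hF).symm.toCLM.continuous
  set R := (h.isPositive_r₀ hE).symm.toCLM
  set Z := (h.isAdjointPair_z₀ hE hF).toCLM
  set Z' := (h.isAdjointPair_z₀ hE hF).symm.toCLM
  -- The parameter is recovered from `(u, v) = (r x, z x)` as `x = r u + z^* v`, because `r r + z^*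
  -- z = 1`. The graph is thus the fixed-point set of a continuous map.
  have hgr : ((ofAdjointPair (h.isAdjointPair_z₀ hE hF)).ofTransform.gr :
      Set (E₀.toSubmodule × F₀.toSubmodule)) =
      {p | p.1 = R (R p.1 + Z' p.2) ∧ p.2 = Z (R p.1 + Z' p.2)} := by
    ext ⟨u, v⟩
    refine (h.mem_gr_ofTransform hE hF).trans ⟨?_, fun hp => ⟨_, hp⟩⟩
    rintro ⟨x, rfl, rfl⟩
    have hx : R (R x) + Z' (Z x) = x := by
      rw [show Z' (Z x) = x - R (R x) from h.z₀_z₀ hE hF x, add_sub_cancel]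
    change R x = R (R (R x) + Z' (Z x)) ∧ Z x = Z (R (R x) + Z' (Z x))
    rw [hx]
    exact ⟨rfl, rfl⟩
  change IsClosed ((ofAdjointPair (h.isAdjointPair_z₀ hE hF)).ofTransform.gr :
      Set (E₀.toSubmodule × F₀.toSubmodule))
  rw [hgr]
  refine (isClosed_eq continuous_fst ?_).inter (isClosed_eq continuous_snd ?_) <;> fun_prop

theorem isRegular_ofTransform : (ofAdjointPair (h.isAdjointPair_z₀ hE hF)).ofTransform.IsRegular where
  closed := h.isClosed_ofTransform hE hF
  dense_domain := h.dense_domain_ofTransform hE hF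
  dense_adj_domain := by
    refine (h.symm.dense_range_r₀ hF).mono (Set.range_subset_iff.mpr fun y => ?_)
    exact mem_domain_of_gr (h.mem_gr_adj_ofTransform hE hF (x := h.symm.z₀ hF hE y)
      (h.symm.r_z_mem ⟨y, hF.le y.2⟩))
  dense_range := by
    convert dense_univ
    refine Set.eq_univ_of_forall fun x => ?_
    -- The range is everything: the preimage of `x` is `a x = r (r x)`, whose image under `t_z` is
    -- `z (r x) = b x`.
    refine ⟨h.r₀ hE (h.r₀ hE x), mem_gr_one_add.mpr
      ⟨x - h.r₀ hE (h.r₀ hE x), mem_gr_comp.mpr ⟨h.z₀ hE hF (h.r₀ hE x), ?_, ?_⟩, by abel⟩⟩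
    · exact (h.mem_gr_ofTransform hE hF).mpr ⟨_, rfl, rfl⟩
    · refine h.mem_gr_adj_ofTransform hE hF ?_
      have h1 : ((h.z₀ hE hF (h.r₀ hE x) : F₀.toSubmodule) : F) = h.b x := h.z_r x
      have h2 : ((x - h.r₀ hE (h.r₀ hE x) : E₀.toSubmodule) : E) = x - h.a x :=
        congrArg _ (h.r_r x)
      rw [h1, h2]
      exact h.b_sub_a_mem x

theorem extend_ofTransform_le : (ofAdjointPair (h.isAdjointPair_z₀ hE hF)).ofTransform.extend ≤ t :=
  le_of_gr_le fun _ _ hxy => by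
    obtain ⟨hx, hy, hxy⟩ := mem_gr_extend.mp hxy
    exact h.mem_gr_of_mem_gr_ofTransform hE hF hxy

theorem a_b_mem_gr_extend (x : E) :
    (h.a x, h.b x) ∈ (ofAdjointPair (h.isAdjointPair_z₀ hE hF)).ofTransform.extend.gr := by
  rw [mem_gr_extend, ← h.r_r, ← h.z_r]
  exact ⟨hE.ge (h.r_mem_closure _), hF.ge (h.z_mem _), (h.mem_gr_ofTransform hE hF).mpr
    ⟨⟨h.r x, hE.ge (h.r_mem_closure _)⟩, rfl, rfl⟩⟩

/-- The graph of `t_z` contains all pairs `(a x, b x)`; this is enough for its adjoint to be `t^*`. -/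
theorem adj_extend_ofTransform :
    (ofAdjointPair (h.isAdjointPair_z₀ hE hF)).ofTransform.extend.adj = s := by
  set S := (ofAdjointPair (h.isAdjointPair_z₀ hE hF)).ofTransform.extend
  have hab := h.a_b_mem_gr_extend hE hF
  have hess : IsEssential A (S.domain : Set E) :=
    isEssential_of_dense (isEssential_range h.isPositive_a.symm fun _ => h.eq_zero_of_a_eq_zero)
      (subset_closure.trans' (Set.range_subset_iff.mpr fun x => mem_domain_of_gr (hab x)))
  refine ext_gr fun y w => ?_
  rw [mem_gr_adj_iff hess]
  constructor
  · intro hyw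
    -- Testing on the pairs `(a x, b x)` gives `b' y = a w`. Applying `t` gives `y - a' y = b w`,
    -- and the sum of `(a' y, b' y)` and `(b w, w - a w)` in the graph of `s` is `(y, w)`.
    have h1 : h.symm.b y = h.a w := ext_inner (A := A) fun x => by
      rw [← h.isAdjointPair_b, ← h.isPositive_a.symm]
      exact hyw _ _ (hab x)
    have h2 : y - h.symm.a y = h.b w := gr_unique (h1 ▸ h.symm.b_sub_a_mem y) (h.a_b_mem w)
    have h3 := s.gr.add_mem (h.symm.a_b_mem y) (h.b_sub_a_mem w)
    simpa [h1, ← h2] using h3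
  · intro hyw u v huv
    obtain ⟨hu, hv, huv⟩ := mem_gr_extend.mp huv
    exact h.inner_eq (h.mem_gr_of_mem_gr_ofTransform hE hF huv) hyw

end Between

end IsDualPair

end HilbertOp

end HilbertModule

theorem theorem4p15 {A E F : Type*}
    [NonUnitalCStarAlgebra A] [PartialOrder A] [StarOrderedRing A]
    [NormedAddCommGroup E] [NormedSpace ℂ E] [CompleteSpace E] [SMul A E] [CStarModule A E]
    [NormedAddCommGroup F] [NormedSpace ℂ F] [CompleteSpace F] [SMul A F] [CStarModule A F]
    (t : HilbertModule.HilbertOp A E F) (ht : t.IsGraphRegular)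
    (E₀ : HilbertModule.HilbertSubmodule A E) (hE₀ : E₀ = (t.adj.comp t).dom.closure)
    (F₀ : HilbertModule.HilbertSubmodule A F) (hF₀ : F₀ = (t.comp t.adj).dom.closure)
    (z : HilbertModule.HilbertOp A E₀.toSubmodule F₀.toSubmodule) (hz : z = t.zTr.between E₀ F₀) :
    t.zTr.domain = E₀.toSubmodule ∧
    z.IsZd ∧
    z.adj = t.adj.zTr.between F₀ E₀ ∧
    (t.adj.aTr.sqrt.comp t).toLinearPMap.IsClosable ∧
    t.zTr.toLinearPMap =
      (t.adj.aTr.sqrt.comp t).toLinearPMap.closure.domRestrict E₀.toSubmodule ∧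
    t.zTr.null = t.null ∧
    t.zTr.range ⊆ t.range ∧
    t.aTr = (1 - t.adj.zTr.comp t.zTr).adj ∧
    t.adj.aTr = (1 - t.zTr.comp t.adj.zTr).adj ∧
    t.bTr = t.zTr.comp t.aTr.sqrt ∧
    z.ofTransform.IsRegular ∧
    z.ofTransform.extend ≤ t ∧
    t = z.ofTransform.extend.adj.adj := by
  have h := ht.isDualPair
  have hE : (E₀.toSubmodule : Set E) = closure (Set.range h.a) := by
    rw [hE₀]; exact h.coe_closure_dom_adj_comp
  have hF : (F₀.toSubmodule : Set F) = closure (Set.range h.symm.a) := by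
    rw [hF₀]; exact h.symm.coe_closure_dom_adj_comp
  rw [h.zTr_between_eq hE hF] at hz
  subst hz
  refine ⟨SetLike.coe_injective (h.domain_zTr.trans hE.symm), h.isZd_z₀ hE hF, ?_,
    h.isClosable_sqrt_comp, h.zTr_eq_closure hE, h.null_zTr, h.range_zTr, h.aTr_eq_adj,
    h.symm.aTr_eq_adj, h.bTr_eq, h.isRegular_ofTransform hE hF, h.extend_ofTransform_le hE hF, ?_⟩
  · rw [HilbertModule.HilbertOp.adj_ofAdjointPair, h.symm.zTr_between_eq hF hE]
  · rw [h.adj_extend_ofTransform hE hF, h.symm.adj_left]
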